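/- Let $\mathcal A$ be a finite alphabet with $|\mathcal A|\ge 2$ and let $\eta\colon\mathbb Z^2\to\mathcal A$. For $\vec u\in\mathbb Z^2$ let $(T^{\vec u}\eta)(\vec x)=\eta(\vec x+\vec u)$, and let $X_\eta$ be the closure of $\{T^{\vec u}\eta:\vec u\in\mathbb Z^2\}$ in $\mathcal A^{\mathbb Z^2}$ (product topology, $\mathcal A$ discrete). For a finite set $\mathcal S\subset\mathbb Z^2$ let $P_\eta(\mathcal S)$ be the number of distinct restrictions $(T^{\vec u}\eta)|_{\mathcal S}$, $\vec u\in\mathbb Z^2$, and let $R_{n,3}=\{0,\dots,n-1\}\times\{0,1,2\}$. Call $\eta$ *aperiodic* if there is no $\vec m\in\mathbb Z^2\setminus\{\vec 0\}$ with $\eta(\vec x+\vec m)=\eta(\vec x)$ for all $\vec x\in\mathbb Z^2$. A directed line $\ell\subset\mathbb R^2$ is a *nonexpansive direction* for $\eta$ if there are $f\ne g$ in $X_\eta$ that coincide at all points of $\mathbb Z^2$ in the closed half-plane whose boundary is the line through the origin parallel to $\ell$ and which lies to the left of this line, directed as $\ell$ is. Two directed lines are *antiparallel* if they are the same undirected line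 with opposite orientations. A nonempty finite set $\mathcal S\subset\mathbb Z^2$ with $\mathcal S=\mathrm{conv}(\mathcal S)\cap\mathbb Z^2$ is *$\eta$-generating* if for every vertex $x$ of $\mathrm{conv}(\mathcal S)$, every $\vec u\in\mathbb Z^2$ and every $\beta\in X_\eta$ that coincides with $T^{\vec u}\eta$ on $\mathcal S\setminus\{x\}$, one has $\beta(x)=(T^{\vec u}\eta)(x)$. The edges of $\mathcal S$ are the edges of the convex polygon $\mathrm{conv}(\mathcal S)$, oriented so that the polygon lies to their left; if $\mathrm{conv}(\mathcal S)$ has zero area, then $\mathcal S$ has no edges. **Proposition.** Assume that $\eta$ is aperiodic and that there exists $n\in\mathbb N$ with $P_\eta(R_{n,3})\le 3n$. If $\ell$ is a nonexpansive direction for $\eta$, then the directed line $\widehat\ell$ antiparallel to $\ell$ is also a nonexpansive direction for $\eta$. In particular, every $\eta$-generating set $\mathcal S$ has an edge that is parallel to $\widehat\ell$ and has the same orientation as $\widehat\ell$ (that is, an edge antiparallel to $\ell$). -/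

import Mathlib

namespace Nivat

/-- The inclusion of the lattice `ℤ²` in the plane `ℝ²`. -/
def toPlane (p : ℤ × ℤ) : ℝ × ℝ := ((p.1 : ℝ), (p.2 : ℝ))

/-- The determinant of a pair of plane vectors; it is positive when `w` points to the left of `v`. -/
def cross (v w : ℝ × ℝ) : ℝ := v.1 * w.2 - v.2 * w.1

section Dynamics

variable {A : Type*}

/-- The translation `T^u`, `(T^u η)(x) = η (x + u)`. -/
def shift (u : ℤ × ℤ) (η : ℤ × ℤ → A) : ℤ × ℤ → A := fun x => η (x + u)

/-- `η` is periodic if it has a nonzero period vector. -/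
def IsPeriodic (η : ℤ × ℤ → A) : Prop :=
  ∃ m : ℤ × ℤ, m ≠ 0 ∧ ∀ x : ℤ × ℤ, η (x + m) = η x

/-- The set of patterns of shape `S` that occur in `η`. -/
def words (η : ℤ × ℤ → A) (S : Set (ℤ × ℤ)) : Set (S → A) :=
  Set.range fun u : ℤ × ℤ => S.domRestrict (shift u η)

/-- The complexity `P_η(S)`: the number of patterns of the finite shape `S` that occur in `η`. -/
noncomputable def complexity (η : ℤ × ℤ → A) (S : Finset (ℤ × ℤ)) : ℕ :=
  (words η (S : Set (ℤ × ℤ))).ncard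

/-- The rectangle `R_{n,k}` of width `n` and height `k`. -/
noncomputable def rect (n k : ℕ) : Finset (ℤ × ℤ) := Finset.Ico (0 : ℤ) n ×ˢ Finset.Ico (0 : ℤ) k

/-- `X_η`, the closure of the orbit of `η` in the product topology. -/
def orbitClosure [TopologicalSpace A] (η : ℤ × ℤ → A) : Set (ℤ × ℤ → A) :=
  closure (Set.range fun u : ℤ × ℤ => shift u η)

/-- The restriction of `α` to `S₁` extends uniquely to an `η`-coloring of `S₂`. -/
def ExtendsUniquely [TopologicalSpace A] (η : ℤ × ℤ → A) (S₁ S₂ : Set (ℤ × ℤ))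
    (α : ℤ × ℤ → A) : Prop :=
  ∀ β ∈ orbitClosure η, Set.EqOn α β S₁ → Set.EqOn α β S₂

/-- The point `x` of `S` is `η`-generated by `S`: every `η`-coloring of `S \ {x}` extends uniquely
to an `η`-coloring of `S`. -/
def IsGeneratedBy [TopologicalSpace A] (η : ℤ × ℤ → A) (S : Set (ℤ × ℤ)) (x : ℤ × ℤ) : Prop :=
  x ∈ S ∧ ∀ u : ℤ × ℤ, ExtendsUniquely η (S \ {x}) S (shift u η)

end Dynamics

section Geometry

/-- The convex hull, in the plane, of a set of lattice points. -/
def hull (S : Set (ℤ × ℤ)) : Set (ℝ × ℝ) := convexHull ℝ (toPlane '' S)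

/-- `S` is convex: it consists of all the lattice points of its convex hull. -/
def IsLatticeConvex (S : Set (ℤ × ℤ)) : Prop := S = toPlane ⁻¹' hull S

/-- The boundary vertices of `S`: the vertices (extreme points) of its convex hull. -/
def boundaryVertices (S : Set (ℤ × ℤ)) : Set (ℤ × ℤ) :=
  {p | p ∈ S ∧ toPlane p ∈ (hull S).extremePoints ℝ}

/-- The positively oriented boundary edges of `S`, each given by its initial and final vertex. The
edge from `a` to `b` is oriented positively: the convex hull of `S` lies to its left. There are no
edges when the convex hull has zero area. -/
def boundaryEdges (S : Set (ℤ × ℤ)) : Set ((ℤ × ℤ) × (ℤ × ℤ)) :=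
  {e | 0 < MeasureTheory.volume (hull S) ∧
    e.1 ∈ boundaryVertices S ∧ e.2 ∈ boundaryVertices S ∧ e.1 ≠ e.2 ∧
    ∀ q ∈ hull S, 0 ≤ cross (toPlane e.2 - toPlane e.1) (q - toPlane e.1)}

/-- A directed line in the plane, given by a point on it and a nonzero vector along which it
points. -/
structure DirectedLine where
  base : ℝ × ℝ
  dir : ℝ × ℝ
  dir_ne_zero : dir ≠ 0

/-- The underlying undirected line. -/
def DirectedLine.carrier (l : DirectedLine) : Set (ℝ × ℝ) :=
  {x | ∃ t : ℝ, x = l.base + t • l.dir}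

/-- Two directed lines are antiparallel: they are the same undirected line with opposite
orientations. -/
def DirectedLine.IsAntiparallel (l l' : DirectedLine) : Prop :=
  l.carrier = l'.carrier ∧ ∃ t : ℝ, t < 0 ∧ l'.dir = t • l.dir

/-- The half-plane `H(l)` whose positively oriented boundary passes through the origin and is
parallel to `l`: it lies to the left of its boundary. -/
def DirectedLine.halfPlane (l : DirectedLine) : Set (ℝ × ℝ) := {x | 0 ≤ cross l.dir x}

/-- The oriented edge from `e.1` to `e.2` is parallel to the directed line `l`, with the same
orientation. -/
def EdgeParallel (e : (ℤ × ℤ) × (ℤ × ℤ)) (l : DirectedLine) : Prop :=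
  ∃ t : ℝ, 0 < t ∧ toPlane e.2 - toPlane e.1 = t • l.dir

end Geometry

/-- An `η`-generating set: a nonempty, finite, convex set of lattice points all of whose boundary
vertices are `η`-generated by it. -/
def IsGeneratingSet {A : Type*} [TopologicalSpace A] (η : ℤ × ℤ → A) (S : Set (ℤ × ℤ)) : Prop :=
  S.Nonempty ∧ S.Finite ∧ IsLatticeConvex S ∧ ∀ x ∈ boundaryVertices S, IsGeneratedBy η S x

/-- The directed line `l` is a nonexpansive direction for `η`: two different elements of `X_η`
coincide on the half-plane `H(l)`. -/
def IsNonexpansiveDirection {A : Type*} [TopologicalSpace A] (η : ℤ × ℤ → A)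
    (l : DirectedLine) : Prop :=
  ∃ f ∈ orbitClosure η, ∃ g ∈ orbitClosure η, f ≠ g ∧ Set.EqOn f g (toPlane ⁻¹' l.halfPlane)

end Nivat

namespace Nivat

/-! ### Pattern counts and their growth with the shape -/

section Counting

variable {A : Type*}

/-- The patterns of shape `T` that occur in the configurations of `X`. -/
def patterns (X : Set (ℤ × ℤ → A)) (T : Finset (ℤ × ℤ)) : Set (T → A) :=
  (fun (f : ℤ × ℤ → A) (p : T) => f p) '' X

/-- The number of patterns of shape `T` that occur in the configurations of `X`. -/
noncomputable def patternCount (X : Set (ℤ × ℤ → A)) (T : Finset (ℤ × ℤ)) : ℕ :=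
  (patterns X T).ncard

/-- Restriction of patterns to a smaller shape. -/
def restrictPattern {T T' : Finset (ℤ × ℤ)} (h : T ⊆ T') (w : T' → A) : T → A :=
  fun p => w ⟨p, h p.2⟩

theorem patterns_eq_image {T T' : Finset (ℤ × ℤ)} (h : T ⊆ T') (X : Set (ℤ × ℤ → A)) :
    patterns X T = restrictPattern h '' patterns X T' := by
  simp only [patterns, Set.image_image]
  rfl

theorem pattern_eq_iff {T : Finset (ℤ × ℤ)} {f g : ℤ × ℤ → A} :
    ((fun p : T => f p) = fun p : T => g p) ↔ Set.EqOn f g T := by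
  constructor
  · intro h p hp
    exact congrFun h ⟨p, hp⟩
  · intro h
    funext p
    exact h p.2

variable [Finite A]

theorem patternCount_mono_shape (X : Set (ℤ × ℤ → A)) {T T' : Finset (ℤ × ℤ)} (h : T ⊆ T') :
    patternCount X T ≤ patternCount X T' := by
  unfold patternCount
  rw [patterns_eq_image h]
  exact Set.ncard_image_le (Set.toFinite _)

theorem patternCount_pos {X : Set (ℤ × ℤ → A)} (hX : X.Nonempty) (T : Finset (ℤ × ℤ)) :
    1 ≤ patternCount X T :=
  (Set.ncard_pos (Set.toFinite _)).2 (hX.image _)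

theorem patternCount_empty {X : Set (ℤ × ℤ → A)} (hX : X.Nonempty) :
    patternCount X ∅ = 1 := by
  refine le_antisymm ?_ (patternCount_pos hX _)
  unfold patternCount
  rw [Set.ncard_le_one (Set.toFinite _)]
  intro a _ b _
  funext p
  exact absurd p.2 (Finset.notMem_empty _)

/-- Enlarging the set of configurations can only increase the number of patterns gained by enlarging
the shape. -/
theorem patternCount_excess {X Z : Set (ℤ × ℤ → A)} (hZ : Z ⊆ X) {T T' : Finset (ℤ × ℤ)}
    (h : T ⊆ T') :
    patternCount Z T' + patternCount X T ≤ patternCount X T' + patternCount Z T := by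
  have h1 : (patterns X T \ patterns Z T).ncard + patternCount Z T = patternCount X T :=
    Set.ncard_sdiff_add_ncard_of_subset (Set.image_mono hZ) (Set.toFinite _)
  have h2 : (patterns X T' \ patterns Z T').ncard + patternCount Z T' = patternCount X T' :=
    Set.ncard_sdiff_add_ncard_of_subset (Set.image_mono hZ) (Set.toFinite _)
  -- A pattern on `T` missing from `Z` has only extensions missing from `Z`, so missing patterns can
  -- only multiply.
  have h3 : (patterns X T \ patterns Z T).ncard ≤ (patterns X T' \ patterns Z T').ncard := by
    have : patterns X T \ patterns Z T ⊆ restrictPattern h '' (patterns X T' \ patterns Z T') := by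
      rintro w ⟨hw, hw'⟩
      rw [patterns_eq_image h] at hw hw'
      obtain ⟨y, hy, rfl⟩ := hw
      exact ⟨y, ⟨hy, fun hy' => hw' ⟨y, hy', rfl⟩⟩, rfl⟩
    exact (Set.ncard_le_ncard this (Set.toFinite _)).trans (Set.ncard_image_le (Set.toFinite _))
  omega

/-- If enlarging the shape creates no pattern, restriction is injective on patterns. This is how
counting turns into determinism. -/
theorem eqOn_of_patternCount_le {X : Set (ℤ × ℤ → A)} {T T' : Finset (ℤ × ℤ)} (h : T ⊆ T')
    (hle : patternCount X T' ≤ patternCount X T) {f g : ℤ × ℤ → A} (hf : f ∈ X) (hg : g ∈ X)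
    (hfg : Set.EqOn f g T) : Set.EqOn f g T' := by
  have hcard : (restrictPattern h '' patterns X T').ncard = (patterns X T').ncard := by
    rw [← patterns_eq_image h]
    exact le_antisymm (patternCount_mono_shape X h) hle
  have hinj := Set.injOn_of_ncard_image_eq hcard (Set.toFinite _)
  refine pattern_eq_iff.1 (hinj ⟨f, hf, rfl⟩ ⟨g, hg, rfl⟩ ?_)
  funext p
  exact hfg p.2

open Classical in
-- Over each pattern on `T` the fibre of extensions contains the distinct patterns of `F j` and `G
-- j`, so it has at least two elements. If the total is only twice the base, each fibre is exactly
-- that unordered pair, whichever index `j` represents the base pattern.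
theorem two_mul_patternCount_le {ι : Type*} {F G : ι → ℤ × ℤ → A} {T T' : Finset (ℤ × ℤ)}
    (h : T ⊆ T') (hT : ∀ j, Set.EqOn (F j) (G j) T) (hT' : ∀ j, ¬ Set.EqOn (F j) (G j) T') :
    patternCount (Set.range F ∪ Set.range G) T = patternCount (Set.range F) T ∧
    2 * patternCount (Set.range F) T ≤ patternCount (Set.range F ∪ Set.range G) T' ∧
    (patternCount (Set.range F ∪ Set.range G) T' ≤ 2 * patternCount (Set.range F) T →
      ∀ i j, Set.EqOn (F i) (F j) T →
        (Set.EqOn (F i) (F j) T' ∧ Set.EqOn (G i) (G j) T') ∨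
        (Set.EqOn (F i) (G j) T' ∧ Set.EqOn (G i) (F j) T')) := by
  set Z := Set.range F ∪ Set.range G
  have hUeq : patterns Z T = patterns (Set.range F) T := by
    refine Set.Subset.antisymm ?_ (Set.image_mono Set.subset_union_left)
    rintro _ ⟨f, hf | hf, rfl⟩
    · exact ⟨f, hf, rfl⟩
    · obtain ⟨j, rfl⟩ := hf
      exact ⟨F j, ⟨j, rfl⟩, pattern_eq_iff.2 (hT j)⟩
  set U : Finset (T → A) := (patterns (Set.range F) T).toFinite.toFinset with hU
  set V : Finset (T' → A) := (patterns Z T').toFinite.toFinset with hV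
  have hUc : patternCount (Set.range F) T = U.card := Set.ncard_eq_toFinset_card _ _
  have hVc : patternCount Z T' = V.card := Set.ncard_eq_toFinset_card _ _
  have hmaps : ∀ w ∈ V, restrictPattern h w ∈ U := by
    intro w hw
    rw [hU, Set.Finite.mem_toFinset, ← hUeq, patterns_eq_image h]
    exact ⟨w, by simpa [hV] using hw, rfl⟩
  have hcard := Finset.card_eq_sum_card_fiberwise hmaps
  have hmemF : ∀ j, (fun p : T' => F j p) ∈ V := fun j => by
    rw [hV, Set.Finite.mem_toFinset]; exact ⟨F j, Or.inl ⟨j, rfl⟩, rfl⟩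
  have hmemG : ∀ j, (fun p : T' => G j p) ∈ V := fun j => by
    rw [hV, Set.Finite.mem_toFinset]; exact ⟨G j, Or.inr ⟨j, rfl⟩, rfl⟩
  have hfib2 : ∀ u ∈ U, 2 ≤ (V.filter fun w => restrictPattern h w = u).card := by
    intro u hu
    rw [hU, Set.Finite.mem_toFinset] at hu
    obtain ⟨_, ⟨j, rfl⟩, rfl⟩ := hu
    have hsub : ({(fun p : T' => F j p), (fun p : T' => G j p)} : Finset (T' → A)) ⊆
        V.filter fun w => restrictPattern h w = fun p : T => F j p := by
      intro w hw
      simp only [Finset.mem_insert, Finset.mem_singleton] at hw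
      rcases hw with rfl | rfl
      · exact Finset.mem_filter.2 ⟨hmemF j, rfl⟩
      · refine Finset.mem_filter.2 ⟨hmemG j, ?_⟩
        exact pattern_eq_iff.2 (hT j).symm
    refine le_trans ?_ (Finset.card_le_card hsub)
    rw [Finset.card_pair]
    exact fun e => hT' j (pattern_eq_iff.1 e)
  have hsum : U.card * 2 ≤ V.card := by
    rw [hcard, ← smul_eq_mul]
    exact Finset.card_nsmul_le_sum _ _ _ hfib2
  refine ⟨by unfold patternCount; rw [hUeq], by omega, fun hle i j hij => ?_⟩
  have hfib : ∀ u ∈ U, (V.filter fun w => restrictPattern h w = u).card = 2 := by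
    have he : ∑ u ∈ U, 2 = ∑ u ∈ U, (V.filter fun w => restrictPattern h w = u).card := by
      rw [← hcard, Finset.sum_const, smul_eq_mul]; omega
    intro u hu
    exact ((Finset.sum_eq_sum_iff_of_le hfib2).1 he u hu).symm
  have hu : (fun p : T => F j p) ∈ U := by
    rw [hU, Set.Finite.mem_toFinset]; exact ⟨F j, ⟨j, rfl⟩, rfl⟩
  obtain ⟨a, b, hab, hset⟩ := Finset.card_eq_two.1 (hfib _ hu)
  have hin : ∀ w ∈ V, restrictPattern h w = (fun p : T => F j p) → w = a ∨ w = b := by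
    intro w hw hw'
    have : w ∈ V.filter fun w => restrictPattern h w = fun p : T => F j p :=
      Finset.mem_filter.2 ⟨hw, hw'⟩
    rw [hset] at this
    simpa using this
  have h1 := hin _ (hmemF i) (pattern_eq_iff.2 hij)
  have h2 := hin _ (hmemF j) rfl
  have h3 := hin _ (hmemG i) (pattern_eq_iff.2 ((hT i).symm.trans hij))
  have h4 := hin _ (hmemG j) (pattern_eq_iff.2 (hT j).symm)
  have hi : (fun p : T' => F i p) ≠ fun p : T' => G i p := fun e => hT' i (pattern_eq_iff.1 e)
  have hj : (fun p : T' => F j p) ≠ fun p : T' => G j p := fun e => hT' j (pattern_eq_iff.1 e)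
  simp only [← pattern_eq_iff]
  grind

end Counting

/-! ### Deterministic finite-state sequences are periodic -/

section FiniteState

/-- The sequence is two-sided, so a repetition can be found among the C + 1 indices ending at `j`.
From there on the sequence is periodic, hence so at `j` itself, with a period at most C. The
factorial absorbs the dependence of that period on `j`. -/
theorem periodic_of_deterministic {S : Type*} [Finite S] (σ : ℤ → S)
    (h : ∀ i j, σ i = σ j → σ (i + 1) = σ (j + 1)) {C : ℕ} (hC : Nat.card S ≤ C) (j : ℤ) :
    σ (j + (C.factorial : ℕ)) = σ j := by
  have fwd : ∀ (k : ℕ) (i j : ℤ), σ i = σ j → σ (i + k) = σ (j + k) := by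
    intro k
    induction k with
    | zero => intro i j hij; simpa using hij
    | succ k ih =>
      intro i j hij
      have := h _ _ (ih i j hij)
      push_cast
      rwa [← add_assoc, ← add_assoc]
  have hni : ¬ Function.Injective fun k : Fin (C + 1) => σ (j - C + (k : ℕ)) := by
    intro hi
    have := Nat.card_le_card_of_injective _ hi
    rw [Nat.card_fin] at this
    omega
  obtain ⟨k₁, k₂, he, hlt⟩ : ∃ k₁ k₂ : Fin (C + 1), σ (j - C + (k₁ : ℕ)) = σ (j - C + (k₂ : ℕ)) ∧
      k₁ < k₂ := by
    simp only [Function.Injective, not_forall] at hni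
    obtain ⟨a, b, hab, hne⟩ := hni
    rcases lt_or_gt_of_ne hne with hlt | hlt
    · exact ⟨a, b, hab, hlt⟩
    · exact ⟨b, a, hab.symm, hlt⟩
  have hlt' : (k₁ : ℕ) < k₂ := hlt
  have hk₂ := k₂.2
  obtain ⟨d, hd⟩ : ∃ d : ℕ, (k₂ : ℕ) = k₁ + d := ⟨k₂ - k₁, by omega⟩
  have hper : ∀ y : ℤ, j - C + (k₁ : ℕ) ≤ y → σ (y + d) = σ y := by
    intro y hy
    obtain ⟨t, ht⟩ := Int.eq_ofNat_of_zero_le (sub_nonneg.2 hy)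
    have := fwd t _ _ he
    rw [hd] at this
    have e1 : y = j - C + (k₁ : ℕ) + t := by omega
    rw [e1, this]
    congr 1
    push_cast
    ring
  have hmul : ∀ m : ℕ, σ (j + (m * d : ℕ)) = σ j := by
    intro m
    induction m with
    | zero => simp
    | succ m ih =>
      rw [← ih, ← hper (j + (m * d : ℕ)) (by
        have : (0 : ℤ) ≤ ((m * d : ℕ) : ℤ) := Int.natCast_nonneg _
        omega)]
      congr 1
      push_cast
      ring
  have hdvd : d ∣ C.factorial := Nat.dvd_factorial (by omega) (by omega)
  obtain ⟨m, hm⟩ := hdvd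
  rw [hm, mul_comm]
  exact hmul m

/-- The state is the residue of the position mod `Q` together with a word of `m` letters, which
leaves at most Q · |A|^m states. -/
theorem sequence_periodic {A : Type*} [Finite A] (z : ℤ → A) {Q m : ℕ} (hQ : 0 < Q)
    (hdet : ∀ i j : ℤ, (Q : ℤ) ∣ i - j → (∀ k : ℕ, k < m → z (i + k) = z (j + k)) →
      z (i + m) = z (j + m)) {C : ℕ} (hC : Q * Nat.card A ^ m ≤ C) (j : ℤ) :
    z (j + (C.factorial : ℕ)) = z j := by
  have : NeZero Q := ⟨hQ.ne'⟩
  set σ : ℤ → ZMod Q × (Fin m → A) := fun j => ((j : ZMod Q), fun k => z (j + (k : ℕ))) with hσ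
  have key : ∀ i j, σ i = σ j → (Q : ℤ) ∣ i - j ∧ ∀ k : ℕ, k < m → z (i + k) = z (j + k) := by
    intro i j hij
    simp only [hσ, Prod.mk.injEq] at hij
    refine ⟨?_, fun k hk => congrFun hij.2 ⟨k, hk⟩⟩
    exact (ZMod.intCast_eq_intCast_iff_dvd_sub j i Q).1 hij.1.symm
  have hstep : ∀ i j, σ i = σ j → σ (i + 1) = σ (j + 1) := by
    intro i j hij
    obtain ⟨h1, h2⟩ := key i j hij
    simp only [hσ, Prod.mk.injEq] at hij ⊢
    refine ⟨by push_cast; rw [hij.1], ?_⟩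
    funext ⟨k, hk⟩
    have e : ∀ i : ℤ, i + 1 + (k : ℕ) = i + ((k + 1 : ℕ) : ℤ) := fun i => by push_cast; ring
    simp only [e]
    rcases Nat.lt_or_ge (k + 1) m with hlt | hge
    · exact h2 _ hlt
    · obtain rfl : k + 1 = m := by omega
      exact hdet _ _ h1 h2
  have hcard : Nat.card (ZMod Q × (Fin m → A)) ≤ C := by
    rw [Nat.card_prod, Nat.card_zmod, Nat.card_fun, Nat.card_fin]
    exact hC
  have := key _ _ (periodic_of_deterministic σ hstep hcard (j - m))
  have h3 := hdet _ _ this.1 this.2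
  convert h3 using 2 <;> ring

end FiniteState

/-! ### Vertical lines, column shapes and relative Morse–Hedlund -/

section Lines

variable {A : Type*}

/-- The vertical segment `{i} × [lo, lo + s)`. -/
noncomputable def column (i lo : ℤ) (s : ℕ) : Finset (ℤ × ℤ) := {i} ×ˢ Finset.Ico lo (lo + s)

theorem mem_column {i lo : ℤ} {s : ℕ} {p : ℤ × ℤ} :
    p ∈ column i lo s ↔ p.1 = i ∧ lo ≤ p.2 ∧ p.2 < lo + s := by
  rw [column, Finset.mem_product, Finset.mem_singleton, Finset.mem_Ico]

/-- The union of the segments `{i} × [lo i, lo i + s i)` for `a ≤ i ≤ b`. -/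
noncomputable def region (lo : ℤ → ℤ) (s : ℤ → ℕ) (a b : ℤ) : Finset (ℤ × ℤ) :=
  (Finset.Icc a b).biUnion fun i => column i (lo i) (s i)

theorem mem_region {lo : ℤ → ℤ} {s : ℤ → ℕ} {a b : ℤ} {p : ℤ × ℤ} :
    p ∈ region lo s a b ↔ (a ≤ p.1 ∧ p.1 ≤ b) ∧ lo p.1 ≤ p.2 ∧ p.2 < lo p.1 + s p.1 := by
  simp only [region, Finset.mem_biUnion, Finset.mem_Icc, mem_column]
  constructor
  · rintro ⟨i, hi, rfl, h⟩
    exact ⟨hi, h⟩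
  · rintro ⟨h1, h2⟩
    exact ⟨p.1, h1, rfl, h2⟩

theorem region_eq_empty {lo : ℤ → ℤ} {s : ℤ → ℕ} {a b : ℤ} (h : b < a) : region lo s a b = ∅ := by
  ext p
  simp only [mem_region, Finset.notMem_empty, iff_false]
  omega

theorem region_left {lo : ℤ → ℤ} {s : ℤ → ℕ} {a b : ℤ} (h : a ≤ b) :
    region lo s a b = region lo s (a + 1) b ∪ column a (lo a) (s a) := by
  ext ⟨x, y⟩
  simp only [mem_region, Finset.mem_union, mem_column]
  constructor
  · rintro ⟨h1, h2⟩
    rcases eq_or_ne x a with rfl | hne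
    · exact Or.inr ⟨rfl, h2⟩
    · exact Or.inl ⟨by omega, h2⟩
  · rintro (⟨h1, h2⟩ | ⟨rfl, h2⟩)
    · exact ⟨by omega, h2⟩
    · exact ⟨by omega, h2⟩

theorem region_right {lo : ℤ → ℤ} {s : ℤ → ℕ} {a b : ℤ} (h : a ≤ b) :
    region lo s a b = region lo s a (b - 1) ∪ column b (lo b) (s b) := by
  ext ⟨x, y⟩
  simp only [mem_region, Finset.mem_union, mem_column]
  constructor
  · rintro ⟨h1, h2⟩
    rcases eq_or_ne x b with rfl | hne
    · exact Or.inr ⟨rfl, h2⟩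
    · exact Or.inl ⟨by omega, h2⟩
  · rintro (⟨h1, h2⟩ | ⟨rfl, h2⟩)
    · exact ⟨by omega, h2⟩
    · exact ⟨by omega, h2⟩

theorem sum_Icc_left (s : ℤ → ℕ) {a b : ℤ} (h : a ≤ b) :
    ∑ i ∈ Finset.Icc a b, s i = s a + ∑ i ∈ Finset.Icc (a + 1) b, s i := by
  have : Finset.Icc a b = insert a (Finset.Icc (a + 1) b) := by
    ext x; simp only [Finset.mem_insert, Finset.mem_Icc]; omega
  rw [this, Finset.sum_insert (by simp)]

theorem sum_Icc_right {M : Type*} [AddCommMonoid M] (s : ℤ → M) {a b : ℤ} (h : a ≤ b) :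
    ∑ i ∈ Finset.Icc a b, s i = s b + ∑ i ∈ Finset.Icc a (b - 1), s i := by
  have : Finset.Icc a b = insert b (Finset.Icc a (b - 1)) := by
    ext x; simp only [Finset.mem_insert, Finset.mem_Icc]; omega
  rw [this, Finset.sum_insert (by simp)]

/-- The restriction of `f` to the vertical line `{i} × ℤ` has period `Q`. -/
def LinePeriodic (f : ℤ × ℤ → A) (i : ℤ) (Q : ℕ) : Prop := ∀ j : ℤ, f (i, j + (Q : ℕ)) = f (i, j)

theorem LinePeriodic.eq_of_dvd {f : ℤ × ℤ → A} {i : ℤ} {Q : ℕ} (h : LinePeriodic f i Q) {j j' : ℤ}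
    (hj : (Q : ℤ) ∣ j - j') : f (i, j) = f (i, j') := by
  obtain ⟨m, hm⟩ := hj
  have := (show Function.Periodic (fun j => f (i, j)) (Q : ℤ) from h).int_mul m j'
  simp only [Int.cast_id] at this
  rw [← this]
  congr 2
  linarith

theorem LinePeriodic.of_dvd {f : ℤ × ℤ → A} {i : ℤ} {Q Q' : ℕ} (h : LinePeriodic f i Q)
    (hQ : Q ∣ Q') : LinePeriodic f i Q' := fun j =>
  h.eq_of_dvd (by rw [add_sub_cancel_left]; exact_mod_cast hQ)

theorem LinePeriodic.of_factorial_le {f : ℤ × ℤ → A} {i : ℤ} {C C' : ℕ}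
    (h : LinePeriodic f i C.factorial) (hC : C ≤ C') : LinePeriodic f i C'.factorial :=
  h.of_dvd (Nat.factorial_dvd_factorial hC)

/-- The translates of `f` by the vectors `(i, j)`, where `i` is fixed. -/
def verticalShifts (f : ℤ × ℤ → A) (i : ℤ) : Set (ℤ × ℤ → A) :=
  Set.range fun j : ℤ => shift (i, j) f

theorem verticalShifts_nonempty (f : ℤ × ℤ → A) (i : ℤ) : (verticalShifts f i).Nonempty :=
  Set.range_nonempty _

variable [Finite A]

/-- A Morse–Hedlund theorem relative to a shape `T` on which the vertical translates of `f` are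
periodic. -/
theorem linePeriodic_of_patternCount_lt {f : ℤ × ℤ → A} {i₀ x lo : ℤ} {T : Finset (ℤ × ℤ)} {Q s : ℕ}
    (hQ : 0 < Q) (hper : ∀ p ∈ T, LinePeriodic f (p.1 + i₀) Q)
    (h : patternCount (verticalShifts f i₀) (T ∪ column x lo s) <
      patternCount (verticalShifts f i₀) T + s) {C : ℕ} (hC : Q * Nat.card A ^ s ≤ C) :
    LinePeriodic f (x + i₀) C.factorial := by
  have hA : 0 < Nat.card A := Nat.card_pos_iff.2 ⟨⟨f 0⟩, inferInstance⟩
  set Z := verticalShifts f i₀ with hZ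
  -- The `s` points are added from the bottom up. Since fewer than `s` patterns appear, some point
  -- adds none and is determined by `T` and the `m` points below it. By `hper`, the pattern on `T`
  -- depends only on the height mod `Q`.
  obtain ⟨m, hm, hle⟩ : ∃ m < s, patternCount Z (T ∪ column x lo (m + 1)) ≤
      patternCount Z (T ∪ column x lo m) := by
    by_contra! hcon
    have : ∀ m ≤ s, patternCount Z T + m ≤ patternCount Z (T ∪ column x lo m) := by
      intro m
      induction m with
      | zero => intro _; exact patternCount_mono_shape _ Finset.subset_union_left
      | succ m ih =>
        intro hm
        have h1 := ih (by omega)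
        have h2 := hcon m (by omega)
        omega
    have := this s le_rfl
    omega
  have hsub : T ∪ column x lo m ⊆ T ∪ column x lo (m + 1) := by
    apply Finset.union_subset_union_right
    intro p hp
    rw [mem_column] at hp ⊢
    push_cast
    omega
  refine fun j => sequence_periodic (fun j => f (x + i₀, j)) (m := m) hQ ?_ ?_ j
  · intro i j hij hw
    have hE : Set.EqOn (shift (i₀, i - lo) f) (shift (i₀, j - lo) f)
        ((T ∪ column x lo m : Finset (ℤ × ℤ)) : Set (ℤ × ℤ)) := by
      rintro ⟨a, b⟩ hp
      rw [Finset.mem_coe, Finset.mem_union, mem_column] at hp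
      simp only [shift, Prod.mk_add_mk]
      rcases hp with hp | ⟨rfl, h1, h2⟩
      · refine (hper _ hp).eq_of_dvd ?_
        convert hij using 1
        ring
      · simp only at h1 h2 ⊢
        obtain ⟨k, hk⟩ := Int.eq_ofNat_of_zero_le (sub_nonneg.2 h1)
        have := hw k (by omega)
        convert this using 3 <;> omega
    have := eqOn_of_patternCount_le hsub hle ⟨_, rfl⟩ ⟨_, rfl⟩ hE
      (show (x, lo + m) ∈ _ from by
        rw [Finset.mem_coe, Finset.mem_union, mem_column]
        right
        push_cast
        omega)
    simp only [shift, Prod.mk_add_mk] at this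
    convert this using 3 <;> ring
  · exact (Nat.mul_le_mul_left _ (Nat.pow_le_pow_right hA hm.le)).trans hC

theorem linePeriodic_of_patternCount_column_le {f : ℤ × ℤ → A} {i₀ x lo : ℤ} {s : ℕ}
    (h : patternCount (verticalShifts f i₀) (column x lo s) ≤ s) {C : ℕ}
    (hC : Nat.card A ^ s ≤ C) : LinePeriodic f (x + i₀) C.factorial := by
  refine linePeriodic_of_patternCount_lt (T := ∅) (Q := 1) (s := s) (lo := lo) one_pos
    (by simp) ?_ (by simpa using hC)
  rw [patternCount_empty (verticalShifts_nonempty f i₀), Finset.empty_union]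
  omega

end Lines

/-! ### Pairs of configurations that first differ on a line -/

section Events

variable {A : Type*}

/-- The segment `{a} × [l, l + q]` lies to the left of the shape `T`, adding it to `T` yields at
most `q` new patterns, and its two end points are determined by the rest. -/
structure IsGeneratingSegment (X : Set (ℤ × ℤ → A)) (T : Finset (ℤ × ℤ)) (a l : ℤ) (q : ℕ) :
    Prop where
  lt : ∀ p ∈ T, a < p.1
  count : patternCount X (T ∪ column a l (q + 1)) ≤ patternCount X T + q
  top : ∀ f ∈ X, ∀ g ∈ X, Set.EqOn f g (T ∪ column a l q : Finset (ℤ × ℤ)) →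
    f (a, l + q) = g (a, l + q)
  bot : ∀ f ∈ X, ∀ g ∈ X, Set.EqOn f g (T ∪ column a (l + 1) q : Finset (ℤ × ℤ)) →
    f (a, l) = g (a, l)

variable {X : Set (ℤ × ℤ → A)} {T : Finset (ℤ × ℤ)} {a l : ℤ} {q : ℕ}

theorem shift_eqOn_union_column {f g : ℤ × ℤ → A} {a l' : ℤ} {u u' : ℤ} {k : ℕ}
    (hT : ∀ p ∈ T, f (p.1 - a, p.2 + u) = g (p.1 - a, p.2 + u'))
    (hc : ∀ i : ℕ, i < k → f (0, l' + u + i) = g (0, l' + u' + i)) :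
    Set.EqOn (shift (-a, u) f) (shift (-a, u') g) (T ∪ column a l' k : Finset (ℤ × ℤ)) := by
  rintro ⟨x, y⟩ hp
  rw [Finset.mem_coe, Finset.mem_union, mem_column] at hp
  simp only [shift, Prod.mk_add_mk, ← sub_eq_add_neg]
  rcases hp with hp | ⟨rfl, h1, h2⟩
  · exact hT _ hp
  · simp only at h1 h2 ⊢
    obtain ⟨i, hi⟩ := Int.eq_ofNat_of_zero_le (sub_nonneg.2 h1)
    have := hc i (by omega)
    convert this using 3 <;> omega

theorem IsGeneratingSegment.exists_ne (hT : IsGeneratingSegment X T a l q)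
    (hX : ∀ u, ∀ f ∈ X, shift u f ∈ X) {f g : ℤ × ℤ → A} (hf : f ∈ X) (hg : g ∈ X)
    (hfg : ∀ i j : ℤ, 1 ≤ i → f (i, j) = g (i, j)) {j₀ : ℤ} (hne : f (0, j₀) ≠ g (0, j₀)) (j : ℤ) :
    ∃ k : ℕ, k < q ∧ f (0, j + k) ≠ g (0, j + k) := by
  by_contra! hcon
  have hTT : ∀ u, ∀ p ∈ T, f (p.1 - a, p.2 + u) = g (p.1 - a, p.2 + u) := by
    intro u p hp
    have := hT.lt p hp
    exact hfg _ _ (by omega)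
  have hup : ∀ n : ℕ, f (0, j + n) = g (0, j + n) := by
    intro n
    induction n using Nat.strong_induction_on with
    | _ n ih =>
      rcases Nat.lt_or_ge n q with hlt | hge
      · exact hcon n hlt
      · have h1 := hT.top _ (hX (-a, j + n - q - l) f hf) _ (hX (-a, j + n - q - l) g hg)
          (shift_eqOn_union_column (hTT _) (by
            intro i hi
            have := ih (n - q + i) (by omega)
            convert this using 3 <;> push_cast [Nat.cast_sub hge] <;> ring))
        simp only [shift, Prod.mk_add_mk] at h1
        convert h1 using 3 <;> ring
  have hdown : ∀ n : ℕ, ∀ j' : ℤ, j - n ≤ j' → f (0, j') = g (0, j') := by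
    intro n
    induction n with
    | zero =>
      intro j' hj'
      obtain ⟨i, hi⟩ := Int.eq_ofNat_of_zero_le (sub_nonneg.2 hj')
      have := hup i
      convert this using 3 <;> push_cast at hi <;> omega
    | succ n ih =>
      intro j' hj'
      rcases le_or_gt (j - n) j' with h1 | h1
      · exact ih _ h1
      · have h1 := hT.bot _ (hX (-a, j' - l) f hf) _ (hX (-a, j' - l) g hg)
          (shift_eqOn_union_column (hTT _) (by
            intro i hi
            exact ih _ (by push_cast at hj'; omega)))
        simp only [shift, Prod.mk_add_mk] at h1
        convert h1 using 3 <;> ring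
  exact hne (hdown (j - j₀).toNat j₀ (by omega))

theorem range_shift_eq_verticalShifts (f : ℤ × ℤ → A) (i l : ℤ) :
    (Set.range fun j : ℤ => shift (i, j - l) f) = verticalShifts f i := by
  ext h
  constructor
  · rintro ⟨j, rfl⟩
    exact ⟨j - l, rfl⟩
  · rintro ⟨j, rfl⟩
    exact ⟨j + l, by simp⟩

variable [Finite A]

/-- Take the least length k, over all positions, for which fewer than k patterns are gained. Either
subsegment of length k - 1 gains at least k - 1, so the remaining end point gains nothing and is
determined. -/
theorem exists_isGeneratingSegment {lo : ℤ} {s : ℕ}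
    (hT : ∀ p ∈ T, a < p.1)
    (h : patternCount X (T ∪ column a lo s) < patternCount X T + s) :
    ∃ l q, q + 1 ≤ s ∧ IsGeneratingSegment X T a l q := by
  classical
  have hex : ∃ k, ∃ l, patternCount X (T ∪ column a l k) < patternCount X T + k := ⟨s, lo, h⟩
  obtain ⟨l, hl⟩ := Nat.find_spec hex
  have hmin : ∀ m, m < Nat.find hex → ∀ l,
      patternCount X T + m ≤ patternCount X (T ∪ column a l m) := by
    intro m hm l
    have := Nat.find_min hex hm
    push Not at this
    exact this l
  have hle : Nat.find hex ≤ s := Nat.find_min' hex ⟨lo, h⟩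
  generalize Nat.find hex = k at hl hmin hle
  have hk : k ≠ 0 := by
    rintro rfl
    have := patternCount_mono_shape X (Finset.subset_union_left (s₁ := T) (s₂ := column a l 0))
    omega
  obtain ⟨q, rfl⟩ := Nat.exists_eq_succ_of_ne_zero hk
  have hsub : ∀ l' , (l' = l ∨ l' = l + 1) →
      T ∪ column a l' q ⊆ T ∪ column a l (q + 1) := by
    intro l' hl'
    apply Finset.union_subset_union_right
    intro p hp
    rw [mem_column] at hp ⊢
    push_cast
    omega
  have hdet : ∀ l', (l' = l ∨ l' = l + 1) → ∀ f ∈ X, ∀ g ∈ X,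
      Set.EqOn f g (T ∪ column a l' q : Finset (ℤ × ℤ)) →
      Set.EqOn f g (T ∪ column a l (q + 1) : Finset (ℤ × ℤ)) := by
    intro l' hl' f hf g hg hfg
    refine eqOn_of_patternCount_le (hsub l' hl') ?_ hf hg hfg
    have := hmin q (by omega) l'
    simp only [Nat.succ_eq_add_one] at hl
    omega
  refine ⟨l, q, by omega, hT, by simp only [Nat.succ_eq_add_one] at hl; omega, ?_, ?_⟩
  · intro f hf g hg hfg
    refine hdet l (Or.inl rfl) f hf g hg hfg ?_
    rw [Finset.mem_coe, Finset.mem_union, mem_column]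
    right
    push_cast
    omega
  · intro f hf g hg hfg
    refine hdet (l + 1) (Or.inr rfl) f hf g hg hfg ?_
    rw [Finset.mem_coe, Finset.mem_union, mem_column]
    right
    push_cast
    omega

theorem IsGeneratingSegment.linePeriodic_zero (hT : IsGeneratingSegment X T a l q)
    (hX : ∀ u, ∀ f ∈ X, shift u f ∈ X) {f : ℤ × ℤ → A} (hf : f ∈ X) {Q : ℕ} (hQ : 0 < Q)
    (hper : ∀ p ∈ T, LinePeriodic f (p.1 - a) Q) {C : ℕ} (hC : Q * Nat.card A ^ q ≤ C) :
    LinePeriodic f 0 C.factorial := by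
  refine fun j => sequence_periodic (fun j => f (0, j)) (m := q) hQ ?_ hC j
  intro i j hij hw
  have h1 := hT.top _ (hX (-a, i - l) f hf) _ (hX (-a, j - l) f hf)
    (shift_eqOn_union_column (by
      intro p hp
      refine (hper p hp).eq_of_dvd ?_
      convert hij using 1
      ring) (by
      intro k hk
      convert hw k hk using 3 <;> ring))
  simp only [shift, Prod.mk_add_mk] at h1
  convert h1 using 3 <;> ring

/-- The data attached to two configurations that agree to the right of a line and differ on it. -/
theorem IsGeneratingSegment.count_le (hT : IsGeneratingSegment X T a l q)
    (hX : ∀ u, ∀ f ∈ X, shift u f ∈ X) {f g : ℤ × ℤ → A} (hf : f ∈ X) (hg : g ∈ X)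
    (hfg : ∀ i j : ℤ, 1 ≤ i → f (i, j) = g (i, j)) {j₀ : ℤ} (hne : f (0, j₀) ≠ g (0, j₀)) :
    patternCount (verticalShifts f (-a)) T ≤ q ∧
    (patternCount (verticalShifts f (-a)) T = q → ∀ i j : ℤ,
      Set.EqOn (shift (-a, i - l) f) (shift (-a, j - l) f) T →
        (∀ k : ℕ, k ≤ q → f (0, i + k) = f (0, j + k) ∧ g (0, i + k) = g (0, j + k)) ∨
        (∀ k : ℕ, k ≤ q → f (0, i + k) = g (0, j + k) ∧ g (0, i + k) = f (0, j + k))) := by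
  set F : ℤ → ℤ × ℤ → A := fun j => shift (-a, j - l) f
  set G : ℤ → ℤ × ℤ → A := fun j => shift (-a, j - l) g
  have hval : ∀ (h : ℤ × ℤ → A) (j : ℤ) (k : ℕ),
      shift (-a, j - l) h (a, l + k) = h (0, j + k) := by
    intro h j k
    simp only [shift, Prod.mk_add_mk]
    congr 2 <;> ring
  have hmem : ∀ k : ℕ, k ≤ q → (a, l + (k : ℤ)) ∈ T ∪ column a l (q + 1) := by
    intro k hk
    rw [Finset.mem_union, mem_column]
    right
    push_cast
    omega
  have h1 : ∀ j, Set.EqOn (F j) (G j) T := by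
    intro j p hp
    have := hT.lt p hp
    exact hfg _ _ (show 1 ≤ p.1 + -a by omega)
  have h2 : ∀ j, ¬ Set.EqOn (F j) (G j) (T ∪ column a l (q + 1) : Finset (ℤ × ℤ)) := by
    intro j he
    obtain ⟨k, hk, hkne⟩ := hT.exists_ne hX hf hg hfg hne j
    apply hkne
    rw [← hval f, ← hval g]
    exact he (hmem k hk.le)
  obtain ⟨e1, e2, e3⟩ := two_mul_patternCount_le (Finset.subset_union_left) h1 h2
  have hZ : Set.range F ∪ Set.range G ⊆ X := by
    rintro _ (⟨j, rfl⟩ | ⟨j, rfl⟩)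
    · exact hX _ _ hf
    · exact hX _ _ hg
  -- The extension doubles the number of patterns of `f` on `T`, while at most `q` patterns may be
  -- gained. Hence there are at most `q` of them, and equality is the rigid case of
  -- `two_mul_patternCount_le`.
  have e4 := patternCount_excess hZ
    (Finset.subset_union_left (s₁ := T) (s₂ := column a l (q + 1)))
  have e5 := hT.count
  rw [e1] at e4
  rw [show Set.range F = verticalShifts f (-a) from range_shift_eq_verticalShifts f (-a) l] at *
  refine ⟨by omega, fun hq i j hij => ?_⟩
  rcases e3 (by omega) i j hij with ⟨h, h'⟩ | ⟨h, h'⟩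
  · left
    intro k hk
    have a1 := h (hmem k hk)
    have a2 := h' (hmem k hk)
    simp only [F, G, hval] at a1 a2
    exact ⟨a1, a2⟩
  · right
    intro k hk
    have a1 := h (hmem k hk)
    have a2 := h' (hmem k hk)
    simp only [F, G, hval] at a1 a2
    exact ⟨a1, a2⟩

theorem IsGeneratingSegment.two_periodic_or (hT : IsGeneratingSegment X T a l q) (hq : q ≤ 2)
    (hX : ∀ u, ∀ f ∈ X, shift u f ∈ X) {f g : ℤ × ℤ → A} (hf : f ∈ X) (hg : g ∈ X)
    (hfg : ∀ i j : ℤ, 1 ≤ i → f (i, j) = g (i, j)) {j₀ : ℤ} (hne : f (0, j₀) ≠ g (0, j₀)) :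
    (∀ p ∈ T, LinePeriodic f (p.1 - a) 2) ∨
      (q = 2 ∧ (∀ j, f (0, j) ≠ g (0, j)) ∧ LinePeriodic f 0 (Nat.card A).factorial) := by
  set F : ℤ → ℤ × ℤ → A := fun j => shift (-a, j - l) f with hF
  by_cases hall : ∀ j, Set.EqOn (F j) (F (j + 2)) T
  · left
    intro p hp j
    have := hall (j - p.2 + l) hp
    simp only [hF, shift] at this
    symm
    convert this using 3 <;> first | omega | (simp only [Prod.snd_add]; push_cast; omega) | rfl
  right
  push Not at hall
  obtain ⟨J, hJ⟩ := hall
  obtain ⟨hU, hpair⟩ := hT.count_le hX hf hg hfg hne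
  set U := patterns (verticalShifts f (-a)) T with hUdef
  have hmemU : ∀ j, (fun p : T => F j p) ∈ U := fun j => ⟨F j, ⟨j - l, rfl⟩, rfl⟩
  have hJ' : (fun p : T => F J p) ≠ fun p : T => F (J + 2) p := fun e => hJ (pattern_eq_iff.1 e)
  have hsub : ({(fun p : T => F J p), (fun p : T => F (J + 2) p)} : Set (T → A)) ⊆ U := by
    rintro w (rfl | rfl)
    exacts [hmemU _, hmemU _]
  have hUU : U.ncard = patternCount (verticalShifts f (-a)) T := rfl
  have h2 : 2 ≤ U.ncard := by
    rw [← Set.ncard_pair hJ']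
    exact Set.ncard_le_ncard hsub (Set.toFinite _)
  have hUeq : ({(fun p : T => F J p), (fun p : T => F (J + 2) p)} : Set (T → A)) = U := by
    refine Set.eq_of_subset_of_ncard_le hsub ?_ (Set.toFinite _)
    rw [Set.ncard_pair hJ']
    omega
  have hcases : ∀ j, Set.EqOn (F j) (F J) T ∨ Set.EqOn (F j) (F (J + 2)) T := by
    intro j
    have := hmemU j
    rw [← hUeq] at this
    rcases this with h | h
    · exact Or.inl (pattern_eq_iff.1 h)
    · exact Or.inr (pattern_eq_iff.1 h)
  obtain rfl : q = 2 := by omega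
  refine ⟨rfl, ?_⟩
  have hpair := hpair (by omega)
  -- the unordered pairs of words of length two that occur in the two sequences
  set π : ℤ → Set (A × A) := fun j =>
    {(f (0, j), f (0, j + 1)), (g (0, j), g (0, j + 1))} with hπ
  have hπ2 : ∀ i j, Set.EqOn (F i) (F j) T → π i = π j ∧ π (i + 1) = π (j + 1) := by
    intro i j hij
    rcases hpair i j hij with h | h
    · have h0 := h 0 (by norm_num)
      have h1 := h 1 (by norm_num)
      have h2 := h 2 (by norm_num)
      simp only [Nat.cast_zero, add_zero, Nat.cast_one, Nat.cast_ofNat] at h0 h1 h2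
      simp only [hπ, add_assoc, one_add_one_eq_two]
      rw [h0.1, h0.2, h1.1, h1.2, h2.1, h2.2]
      exact ⟨rfl, rfl⟩
    · have h0 := h 0 (by norm_num)
      have h1 := h 1 (by norm_num)
      have h2 := h 2 (by norm_num)
      simp only [Nat.cast_zero, add_zero, Nat.cast_one, Nat.cast_ofNat] at h0 h1 h2
      simp only [hπ, add_assoc, one_add_one_eq_two]
      rw [h0.1, h0.2, h1.1, h1.2, h2.1, h2.2]
      exact ⟨Set.pair_comm _ _, Set.pair_comm _ _⟩
  -- The pattern at height J + 1 repeats the one at `J` or at `J + 2`. In either case the pairs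
  -- belonging to the two patterns are identified.
  have hconst : ∃ P, ∀ j, π j = P := by
    rcases hcases (J + 1) with h | h
    · have e1 := hπ2 _ _ h
      refine ⟨π J, fun j => ?_⟩
      rcases hcases j with h' | h'
      · exact (hπ2 _ _ h').1
      · rw [(hπ2 _ _ h').1, ← e1.1, ← e1.2, add_assoc, one_add_one_eq_two]
    · have e1 := hπ2 _ _ h
      refine ⟨π (J + 1), fun j => ?_⟩
      obtain ⟨i, rfl⟩ : ∃ i, j = i + 1 := ⟨j - 1, by ring⟩
      rcases hcases i with h' | h'
      · exact (hπ2 _ _ h').2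
      · rw [(hπ2 _ _ h').2, ← e1.2, add_assoc, one_add_one_eq_two, e1.1]
  obtain ⟨P, hP⟩ := hconst
  have hall : ∀ j, f (0, j) ≠ g (0, j) := by
    intro j he
    have hfst : ∀ w ∈ P, w.1 = f (0, j) := by
      rw [← hP j]
      rintro w (rfl | rfl)
      · rfl
      · exact he.symm
    apply hne
    have m1 : (f (0, j₀), f (0, j₀ + 1)) ∈ P := by rw [← hP j₀]; simp [hπ]
    have m2 : (g (0, j₀), g (0, j₀ + 1)) ∈ P := by rw [← hP j₀]; simp [hπ]
    exact (hfst _ m1).trans (hfst _ m2).symm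
  refine ⟨hall, ?_⟩
  refine fun j => sequence_periodic (fun j => f (0, j)) (m := 1) (Q := 1) one_pos ?_
    (by simp) j
  intro i j _ hw
  have e0 : f (0, i) = f (0, j) := by simpa using hw 0 one_pos
  have m1 : (f (0, i), f (0, i + 1)) ∈ π j := by rw [hP j, ← hP i]; simp [hπ]
  simp only [hπ, Set.mem_insert_iff, Set.mem_singleton_iff, Prod.mk.injEq] at m1
  rcases m1 with h | h
  · simpa using h.2
  -- Since f and g never agree on the line, the current letter tells which word of `P` is read by
  -- `f`, and so determines the next letter.
  · exact absurd (e0.symm.trans h.1) (hall j)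

/-- If every column right of `a` has height at least `q`, the bound of `q` patterns makes each of
these lines periodic by Morse–Hedlund. Otherwise `hshape` forces q ≤ 2 and `two_periodic_or`
applies. For q = 1, every window of one point contains a difference. For q = 2 one has `s a = 3`, so
no column is empty and 2-periodicity on the shape reaches all the lines. -/
theorem IsGeneratingSegment.event {lo : ℤ → ℤ} {s : ℤ → ℕ} {I₀ I₁ : ℤ} {M : ℕ}
    (hT : IsGeneratingSegment X (region lo s (a + 1) I₁) a l q) (hq : q + 1 ≤ s a)
    (ha : I₀ ≤ a) (hM : ∀ i, s i ≤ M)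
    (hshape : (∀ i, I₀ ≤ i → i ≤ I₁ → s a ≤ s i + 1) ∨
      (s a ≤ 3 ∧ (s a = 3 → ∀ i, I₀ ≤ i → i ≤ I₁ → 1 ≤ s i)))
    (hX : ∀ u, ∀ f ∈ X, shift u f ∈ X) {f g : ℤ × ℤ → A} (hf : f ∈ X) (hg : g ∈ X)
    (hfg : ∀ i j : ℤ, 1 ≤ i → f (i, j) = g (i, j)) {j₀ : ℤ} (hne : f (0, j₀) ≠ g (0, j₀))
    {C : ℕ} (hC : 2 * (Nat.card A ^ M).factorial * Nat.card A ^ M ≤ C) :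
    LinePeriodic f 0 C.factorial ∧ ((∀ j, f (0, j) ≠ g (0, j)) ∨
      ∀ i, 1 ≤ i → i ≤ I₁ - a → LinePeriodic f i C.factorial) := by
  have hA : 0 < Nat.card A := Nat.card_pos_iff.2 ⟨⟨f 0⟩, inferInstance⟩
  have hexists := hT.exists_ne hX hf hg hfg hne
  have hq1 : 1 ≤ q := by
    obtain ⟨k, hk, -⟩ := hexists 0
    omega
  have hMa := hM a
  have hfac : 1 ≤ (Nat.card A ^ M).factorial := Nat.factorial_pos _
  have hpowq : Nat.card A ^ q ≤ Nat.card A ^ M := Nat.pow_le_pow_right hA (by omega)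
  have hpow1 : Nat.card A ≤ Nat.card A ^ M := by
    calc Nat.card A = Nat.card A ^ 1 := (pow_one _).symm
      _ ≤ _ := Nat.pow_le_pow_right hA (by omega)
  have hC1 : Nat.card A ^ M ≤ C := by nlinarith
  have hC2 : 2 * Nat.card A ^ q ≤ C := by nlinarith
  have hC3 : (Nat.card A ^ M).factorial * Nat.card A ^ q ≤ C := by nlinarith
  have hC0 : 2 ≤ C := by nlinarith
  have hfacC : (Nat.card A ^ M).factorial ≤ C := by nlinarith
  by_cases hqs : ∀ i, a < i → i ≤ I₁ → q ≤ s i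
  · have hU := (hT.count_le hX hf hg hfg hne).1
    have hlines : ∀ i, a < i → i ≤ I₁ → LinePeriodic f (i - a) (Nat.card A ^ M).factorial := by
      intro i hi hi'
      have hsub : column i (lo i) (s i) ⊆ region lo s (a + 1) I₁ := by
        intro p hp
        rw [mem_column] at hp
        rw [mem_region, hp.1]
        omega
      refine linePeriodic_of_patternCount_column_le (lo := lo i) (s := s i) ?_
        (Nat.pow_le_pow_right hA (hM i))
      exact ((patternCount_mono_shape _ hsub).trans hU).trans (hqs i hi hi')
    refine ⟨hT.linePeriodic_zero hX hf hfac (fun p hp => ?_) hC3, Or.inr fun i hi hi' => ?_⟩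
    · rw [mem_region] at hp
      exact hlines _ (by omega) (by omega)
    · have := hlines (i + a) (by omega) (by omega)
      rw [add_sub_cancel_right] at this
      exact this.of_factorial_le hC1
  · have hq2 : q ≤ 2 ∧ (q = 2 → ∀ i, I₀ ≤ i → i ≤ I₁ → 1 ≤ s i) := by
      rcases hshape with h | ⟨h, h'⟩
      · exfalso
        apply hqs
        intro i hi hi'
        have := h i (by omega) hi'
        omega
      · exact ⟨by omega, fun h2 => h' (by omega)⟩
    rcases hT.two_periodic_or hq2.1 hX hf hg hfg hne with h | ⟨-, h, h'⟩
    · refine ⟨hT.linePeriodic_zero hX hf two_pos h hC2, ?_⟩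
      rcases Nat.lt_or_ge q 2 with hlt | hge
      · left
        intro j
        obtain ⟨k, hk, hk'⟩ := hexists j
        obtain rfl : k = 0 := by omega
        simpa using hk'
      · right
        intro i hi hi'
        have hs := hq2.2 (by omega) (i + a) (by omega) (by omega)
        have := h (i + a, lo (i + a)) (by
          rw [mem_region]
          simp only
          omega)
        simp only [add_sub_cancel_right] at this
        exact this.of_dvd (Nat.dvd_factorial two_pos hC0)
    · exact ⟨h'.of_factorial_le (hpow1.trans hC1), Or.inl h⟩

end Events

/-! ### Uniform periods and the reversal of determinism -/

section Core

variable {A : Type*}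

/-- A rapidly growing sequence of periods, each dividing the next one. -/
def periodBound (c K : ℕ) : ℕ → ℕ
  | 0 => K
  | y + 1 => (periodBound c K y * c).factorial

theorem periodBound_pos {c K : ℕ} (hK : 0 < K) (y : ℕ) : 0 < periodBound c K y := by
  cases y with
  | zero => exact hK
  | succ y => exact Nat.factorial_pos _

theorem periodBound_dvd_succ {c K : ℕ} (hc : 0 < c) (hK : 0 < K) (y : ℕ) :
    periodBound c K y ∣ periodBound c K (y + 1) :=
  Nat.dvd_factorial (periodBound_pos hK y) (Nat.le_mul_of_pos_right _ hc)

theorem dvd_periodBound {c K : ℕ} (hc : 0 < c) (hK : 0 < K) (y : ℕ) : K ∣ periodBound c K y := by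
  induction y with
  | zero => exact dvd_rfl
  | succ y ih => exact ih.trans (periodBound_dvd_succ hc hK y)

variable [Finite A] {X : Set (ℤ × ℤ → A)} {lo : ℤ → ℤ} {s : ℤ → ℕ} {M : ℕ}

/-- Translate so that column `x` falls on line `Y`, which lacks the period, and the other columns
fall on periodic lines. A gain below `s x` would make line `Y` periodic by relative Morse–Hedlund.
-/
theorem patternCount_region_right (hM : ∀ i, s i ≤ M) (hX : ∀ u, ∀ f ∈ X, shift u f ∈ X)
    {f : ℤ × ℤ → A} (hf : f ∈ X) {Q : ℕ} (hQ : 0 < Q) {Y : ℤ}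
    (hper : ∀ i, 1 ≤ i → i < Y → LinePeriodic f i Q)
    (hnot : ¬ LinePeriodic f Y (Q * Nat.card A ^ M).factorial) {i x : ℤ} (hix : i ≤ x)
    (hxi : x - i < Y) :
    patternCount X (region lo s i (x - 1)) + s x ≤ patternCount X (region lo s i x) := by
  have hA : 0 < Nat.card A := Nat.card_pos_iff.2 ⟨⟨f 0⟩, inferInstance⟩
  have hZ : verticalShifts f (Y - x) ⊆ X := by
    rintro _ ⟨j, rfl⟩
    exact hX _ _ hf
  have h1 := patternCount_excess hZ (Finset.subset_union_left (s₁ := region lo s i (x - 1))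
    (s₂ := column x (lo x) (s x)))
  rw [← region_right hix] at h1
  by_contra hcon
  apply hnot
  have := linePeriodic_of_patternCount_lt (f := f) (i₀ := Y - x) (x := x) (lo := lo x)
    (T := region lo s i (x - 1)) (s := s x) hQ (by
      intro p hp
      rw [mem_region] at hp
      exact hper _ (by omega) (by omega)) (by
      rw [← region_right hix]
      omega) (Nat.mul_le_mul_left Q (Nat.pow_le_pow_right hA (hM x)))
  rwa [add_sub_cancel] at this

theorem sum_lt_patternCount_region (hM : ∀ i, s i ≤ M) (hX : ∀ u, ∀ f ∈ X, shift u f ∈ X)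
    {f : ℤ × ℤ → A} (hf : f ∈ X) {Q : ℕ} (hQ : 0 < Q) {Y : ℤ}
    (hper : ∀ i, 1 ≤ i → i < Y → LinePeriodic f i Q)
    (hnot : ¬ LinePeriodic f Y (Q * Nat.card A ^ M).factorial) {i x : ℤ} (hxi : x - i < Y) :
    ∑ k ∈ Finset.Icc i x, s k < patternCount X (region lo s i x) := by
  have hne : X.Nonempty := ⟨f, hf⟩
  rcases lt_or_ge x i with hlt | hge
  · rw [Finset.Icc_eq_empty (by omega), Finset.sum_empty]
    exact patternCount_pos hne _
  have : ∀ n : ℕ, (n : ℤ) < Y →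
      ∑ k ∈ Finset.Icc i (i + n), s k < patternCount X (region lo s i (i + n)) := by
    intro n
    induction n with
    | zero =>
      intro h
      have h1 := patternCount_region_right (lo := lo) hM hX hf hQ hper hnot
        (show i ≤ i + (0 : ℕ) by simp) (by simpa using h)
      rw [region_eq_empty (by simp), patternCount_empty hne] at h1
      simp only [Nat.cast_zero, add_zero, Finset.Icc_self, Finset.sum_singleton] at h1 ⊢
      omega
    | succ n ih =>
      intro h
      push_cast at h
      have h1 := patternCount_region_right (lo := lo) hM hX hf hQ hper hnot
        (show i ≤ i + (n + 1 : ℕ) by push_cast; omega) (by push_cast; omega)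
      rw [sum_Icc_right s (by push_cast; omega)]
      have e : i + ((n + 1 : ℕ) : ℤ) - 1 = i + n := by push_cast; ring
      rw [e] at h1 ⊢
      have := ih (by omega)
      omega
  obtain ⟨n, hn⟩ := Int.eq_ofNat_of_zero_le (sub_nonneg.2 hge)
  have h1 := this n (by omega)
  rwa [show i + (n : ℤ) = x by omega] at h1

theorem patternCount_region_left (hM : ∀ i, s i ≤ M) (hX : ∀ u, ∀ f ∈ X, shift u f ∈ X)
    {f g : ℤ × ℤ → A} (hf : f ∈ X) (hg : g ∈ X)
    (hfg : ∀ i j : ℤ, 1 ≤ i → f (i, j) = g (i, j)) (hne : ∀ j, f (0, j) ≠ g (0, j)) {Y : ℤ}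
    (hY : 1 ≤ Y) (hnot : ¬ LinePeriodic f Y (Nat.card A ^ M).factorial) {i b : ℤ} (hib : i + Y ≤ b)
    (hi : 0 < s i) :
    patternCount X (region lo s (i + 1) b) + s (i + Y) + 1 ≤ patternCount X (region lo s i b) := by
  have hA : 0 < Nat.card A := Nat.card_pos_iff.2 ⟨⟨f 0⟩, inferInstance⟩
  have hsub : region lo s (i + 1) b ⊆ region lo s i b := by
    intro p hp
    rw [mem_region] at hp ⊢
    omega
  obtain ⟨e1, e2, -⟩ := two_mul_patternCount_le (F := fun j : ℤ => shift (-i, j) f)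
    (G := fun j : ℤ => shift (-i, j) g) hsub (by
      intro j p hp
      rw [Finset.mem_coe, mem_region] at hp
      exact hfg _ _ (show 1 ≤ p.1 + -i by omega)) (by
      intro j he
      have := he (show (i, lo i) ∈ _ by
        rw [Finset.mem_coe, mem_region]
        simp only
        omega)
      simp only [shift, Prod.mk_add_mk, add_neg_cancel] at this
      exact hne _ this)
  have hZ : (Set.range fun j : ℤ => shift (-i, j) f) ∪ (Set.range fun j : ℤ => shift (-i, j) g) ⊆
      X := by
    rintro _ (⟨j, rfl⟩ | ⟨j, rfl⟩)
    · exact hX _ _ hf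
    · exact hX _ _ hg
  have e3 := patternCount_excess hZ hsub
  have hcol : column (i + Y) (lo (i + Y)) (s (i + Y)) ⊆ region lo s (i + 1) b := by
    intro p hp
    rw [mem_column] at hp
    rw [mem_region, hp.1]
    omega
  have e4 : s (i + Y) < patternCount (verticalShifts f (-i)) (region lo s (i + 1) b) := by
    by_contra hcon
    apply hnot
    have := linePeriodic_of_patternCount_column_le (f := f) (i₀ := -i) (x := i + Y)
      (lo := lo (i + Y)) (s := s (i + Y))
      ((patternCount_mono_shape _ hcol).trans (by omega)) (Nat.pow_le_pow_right hA (hM _))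
    rwa [show i + Y + -i = Y by ring] at this
  unfold verticalShifts at e4
  omega

/-- The shape `region lo s I₀ I₁` has few patterns, and its vertical sections satisfy the
conditions under which determinism is reversible. -/
structure IsReversingShape (X : Set (ℤ × ℤ → A)) (lo : ℤ → ℤ) (s : ℤ → ℕ) (I₀ I₁ : ℤ) (M : ℕ) :
    Prop where
  le : ∀ i, s i ≤ M
  count : patternCount X (region lo s I₀ I₁) ≤ ∑ i ∈ Finset.Icc I₀ I₁, s i
  sections : (∀ a i, I₀ ≤ a → a ≤ I₁ → I₀ ≤ i → i ≤ I₁ → s a ≤ s i + 1) ∨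
    ((∀ a, s a ≤ 3) ∧ (∀ a, s a = 3 → ∀ i, I₀ ≤ i → i ≤ I₁ → 1 ≤ s i))
  sum_nonneg : ∀ Y, 1 ≤ Y → Y ≤ I₁ - I₀ →
    0 ≤ ∑ i ∈ Finset.Icc I₀ (I₁ - Y), if s i = 0 then (0 : ℤ) else s (i + Y) + 1 - s i

/-- Choose the greatest `a` for which the region from `a` to `I₁` has at most as many patterns as
points. Dropping column `a` breaks the bound, so that column gains fewer than `s a` patterns. Such
an `a` exists and is at most `I₁`, as the empty region has one pattern and no points. -/
theorem IsReversingShape.exists_segment {I₀ I₁ : ℤ} (h : IsReversingShape X lo s I₀ I₁ M)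
    (hne : X.Nonempty) :
    ∃ a l q, I₀ ≤ a ∧ a ≤ I₁ ∧ q + 1 ≤ s a ∧
      patternCount X (region lo s a I₁) ≤ ∑ i ∈ Finset.Icc a I₁, s i ∧
      IsGeneratingSegment X (region lo s (a + 1) I₁) a l q := by
  obtain ⟨a, ⟨ha, hac⟩, hmax⟩ := Int.exists_greatest_of_bdd
    (P := fun a => I₀ ≤ a ∧ patternCount X (region lo s a I₁) ≤ ∑ i ∈ Finset.Icc a I₁, s i)
    ⟨I₁, by
      rintro a ⟨-, ha⟩
      by_contra hlt
      rw [region_eq_empty (by omega), patternCount_empty hne, Finset.Icc_eq_empty (by omega)] at ha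
      simp at ha⟩ ⟨I₀, le_rfl, h.count⟩
  have haI : a ≤ I₁ := by
    by_contra hlt
    rw [region_eq_empty (by omega), patternCount_empty hne, Finset.Icc_eq_empty (by omega)] at hac
    simp at hac
  have hnext : ∑ i ∈ Finset.Icc (a + 1) I₁, s i < patternCount X (region lo s (a + 1) I₁) := by
    by_contra hcon
    have := hmax (a + 1) ⟨by omega, by omega⟩
    omega
  have hlt : patternCount X (region lo s (a + 1) I₁ ∪ column a (lo a) (s a)) <
      patternCount X (region lo s (a + 1) I₁) + s a := by
    rw [← region_left haI]
    rw [sum_Icc_left s haI] at hac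
    omega
  obtain ⟨l, q, hq, hseg⟩ := exists_isGeneratingSegment (by
    intro p hp
    rw [mem_region] at hp
    omega) hlt
  exact ⟨a, l, q, ha, haI, hq, hac, hseg⟩

/-- The essential point is uniformity: `K` and the bounds are independent of the pair `f`, `g`. If
line y + 1 were the first to break its bound, counting columns from both sides would give the whole
shape more patterns than points. -/
theorem IsReversingShape.exists_period {I₀ I₁ : ℤ} (h : IsReversingShape X lo s I₀ I₁ M)
    (hX : ∀ u, ∀ f ∈ X, shift u f ∈ X) (hne : X.Nonempty) :
    ∃ K : ℕ, 0 < K ∧ ∀ f ∈ X, ∀ g ∈ X, (∀ i j : ℤ, 1 ≤ i → f (i, j) = g (i, j)) →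
      ∀ j₀ : ℤ, f (0, j₀) ≠ g (0, j₀) → LinePeriodic f 0 K ∧
        ∀ y : ℕ, ∀ i : ℤ, 1 ≤ i → i ≤ y →
          LinePeriodic f i (periodBound (Nat.card A ^ M) K y) := by
  obtain ⟨a, l, q, ha, haI, hq, hac, hseg⟩ := h.exists_segment hne
  -- Large enough for both period sources in `event`: lines of period 2 and lines of period
  -- (|A|^M)!.
  set C := 2 * (Nat.card A ^ M).factorial * Nat.card A ^ M with hCdef
  refine ⟨C.factorial, Nat.factorial_pos _, fun f hf g hg hfg j₀ hj₀ => ?_⟩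
  have hA : 0 < Nat.card A := Nat.card_pos_iff.2 ⟨⟨f 0⟩, inferInstance⟩
  have hc : 0 < Nat.card A ^ M := Nat.pow_pos hA
  have hK := Nat.factorial_pos C
  have hshape : (∀ i, I₀ ≤ i → i ≤ I₁ → s a ≤ s i + 1) ∨
      (s a ≤ 3 ∧ (s a = 3 → ∀ i, I₀ ≤ i → i ≤ I₁ → 1 ≤ s i)) := by
    rcases h.sections with h1 | h1
    · exact Or.inl fun i hi hi' => h1 a i ha haI hi hi'
    · exact Or.inr ⟨h1.1 a, h1.2 a⟩
  obtain ⟨hzero, hor⟩ := hseg.event hq ha h.le hshape hX hf hg hfg hj₀ (le_refl C)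
  refine ⟨hzero, fun y => ?_⟩
  induction y with
  | zero => intro i hi hi'; simp at hi'; omega
  | succ y ih =>
    intro i hi hi'
    rcases lt_or_ge i (y + 1) with hlt | hge
    · exact (ih i hi (by omega)).of_dvd (periodBound_dvd_succ hc hK y)
    obtain rfl : i = y + 1 := le_antisymm (by exact_mod_cast hi') hge
    by_contra hnot
    have hnot' : ¬ LinePeriodic f (y + 1)
        (periodBound (Nat.card A ^ M) C.factorial y * Nat.card A ^ M).factorial := hnot
    have hbase : ∀ i x : ℤ, x - i < y + 1 →
        ∑ k ∈ Finset.Icc i x, s k < patternCount X (region lo s i x) := fun i x hix =>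
      sum_lt_patternCount_region h.le hX hf (periodBound_pos hK y)
        (fun i hi hi' => ih i hi (by omega)) hnot' hix
    have hlong : (y : ℤ) + 1 ≤ I₁ - I₀ := by
      by_contra hcon
      have := hbase I₀ I₁ (by omega)
      have := h.count
      omega
    -- The region from `a` to `I₁` cannot be narrow, by `hbase` and the choice of `a`. So line y + 1
    -- is among the lines of the second alternative of `event`, which would make it periodic.
    have hall : ∀ j, f (0, j) ≠ g (0, j) := by
      rcases hor with h1 | h1
      · exact h1
      exfalso
      rcases le_or_gt ((y : ℤ) + 1) (I₁ - a) with h2 | h2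
      · exact hnot ((h1 _ hi h2).of_dvd (dvd_periodBound hc hK _))
      · have := hbase a I₁ h2
        omega
    have hnotc : ¬ LinePeriodic f (y + 1) (Nat.card A ^ M).factorial := by
      intro h1
      refine hnot' (h1.of_factorial_le ?_)
      exact Nat.le_mul_of_pos_left _ (periodBound_pos hK y)
    set b : ℤ := I₁ - (y + 1) with hb
    -- `t i` is the guaranteed gain of column `i` minus its size. An empty column gains and costs
    -- nothing, hence the value 0.
    set t : ℤ → ℤ := fun i => if s i = 0 then (0 : ℤ) else s (i + (y + 1)) + 1 - s i with ht
    -- Start with the rightmost y + 1 columns, controlled by `hbase`, and add columns leftwards. At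
    -- `I₀`, `sum_nonneg` makes the count exceed the number of points.
    have hind : ∀ n : ℕ, (n : ℤ) ≤ b - I₀ + 1 →
        (1 : ℤ) + ∑ k ∈ Finset.Icc (b + 1 - n) I₁, (s k : ℤ) + ∑ k ∈ Finset.Icc (b + 1 - n) b, t k ≤
          patternCount X (region lo s (b + 1 - n) I₁) := by
      intro n
      induction n with
      | zero =>
        intro _
        have := hbase (b + 1) I₁ (by omega)
        simp only [Nat.cast_zero, sub_zero]
        rw [Finset.Icc_eq_empty (show ¬ b + 1 ≤ b by omega), Finset.sum_empty]
        have h3 : (∑ k ∈ Finset.Icc (b + 1) I₁, (s k : ℤ)) =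
          ((∑ k ∈ Finset.Icc (b + 1) I₁, s k : ℕ) : ℤ) := by push_cast; rfl
        rw [h3]
        omega
      | succ n ihn =>
        intro hn
        push_cast at hn
        have h1 := ihn (by omega)
        have e : b + 1 - ((n + 1 : ℕ) : ℤ) = b - n := by push_cast; ring
        have e' : b + 1 - (n : ℤ) = (b - n) + 1 := by ring
        rw [e]
        rw [e'] at h1
        have hI : ∀ (r : ℤ → ℤ) (c : ℤ), b - n ≤ c → ∑ k ∈ Finset.Icc (b - n) c, r k =
            r (b - n) + ∑ k ∈ Finset.Icc (b - n + 1) c, r k := by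
          intro r c hc'
          have : Finset.Icc (b - n) c = insert (b - (n : ℤ)) (Finset.Icc (b - n + 1) c) := by
            ext x; simp only [Finset.mem_insert, Finset.mem_Icc]; omega
          rw [this, Finset.sum_insert (by simp)]
        rw [hI _ _ (by omega), hI t _ (by omega)]
        rcases Nat.eq_zero_or_pos (s (b - n)) with h0 | h0
        · have h4 : patternCount X (region lo s (b - n + 1) I₁) ≤
              patternCount X (region lo s (b - n) I₁) := by
            apply patternCount_mono_shape
            intro p hp
            rw [mem_region] at hp ⊢
            omega
          have h5 : t (b - n) = 0 := by simp [ht, h0]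
          rw [h5, h0]
          push_cast
          omega
        · have h4 := patternCount_region_left (lo := lo) h.le hX hf hg hfg hall hi hnotc
            (i := b - n) (b := I₁) (by omega) h0
          have h5 : t (b - n) = s (b - n + (y + 1)) + 1 - s (b - n) := by
            simp only [ht]
            rw [if_neg (by omega)]
          rw [h5]
          omega
    have h1 := hind (b - I₀ + 1).toNat (by omega)
    rw [show b + 1 - ((b - I₀ + 1).toNat : ℤ) = I₀ by omega] at h1
    have h2 := h.sum_nonneg (y + 1) hi hlong
    have h3 := h.count
    have h4 : (∑ k ∈ Finset.Icc I₀ I₁, (s k : ℤ)) =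
      ((∑ k ∈ Finset.Icc I₀ I₁, s k : ℕ) : ℤ) := by push_cast; rfl
    rw [h4] at h1
    change 0 ≤ ∑ k ∈ Finset.Icc I₀ b, t k at h2
    omega

/-- If the configurations of `X` are determined by `N` consecutive lines to the right of these, and
`X` has few patterns of a suitable shape, then they are also determined to the left. -/
theorem IsReversingShape.eq_on_line {I₀ I₁ : ℤ} (h : IsReversingShape X lo s I₀ I₁ M)
    (hX : ∀ u, ∀ f ∈ X, shift u f ∈ X) {N : ℕ}
    (hN : ∀ f ∈ X, ∀ g ∈ X, (∀ i j : ℤ, -N ≤ i → i < 0 → f (i, j) = g (i, j)) →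
      ∀ j, f (0, j) = g (0, j))
    {f g : ℤ × ℤ → A} (hf : f ∈ X) (hg : g ∈ X)
    (hfg : ∀ i j : ℤ, 1 ≤ i → f (i, j) = g (i, j)) (j₀ : ℤ) : f (0, j₀) = g (0, j₀) := by
  by_contra hne
  have hA : 0 < Nat.card A := Nat.card_pos_iff.2 ⟨⟨f 0⟩, inferInstance⟩
  obtain ⟨K, hK, hper⟩ := h.exists_period hX ⟨f, hf⟩
  have hdet : ∀ f ∈ X, ∀ g ∈ X, ∀ x x' : ℤ,
      (∀ i j : ℤ, 0 ≤ i → i < N → f (x + i, j) = g (x' + i, j)) →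
      ∀ j, f (x + N, j) = g (x' + N, j) := by
    intro f hf g hg x x' hxx j
    have := hN _ (hX (x + N, 0) f hf) _ (hX (x' + N, 0) g hg) (by
      intro i j hi hi'
      have := hxx (i + N) j (by omega) (by omega)
      simp only [shift, Prod.mk_add_mk]
      convert this using 2 <;> ring_nf) j
    simpa [shift, Prod.mk_add_mk] using this
  set Q := periodBound (Nat.card A ^ M) K N with hQ
  have hQpos : 0 < Q := periodBound_pos hK N
  have hKQ : K ∣ Q := dvd_periodBound (Nat.pow_pos hA) hK N
  -- Stated for an arbitrary pair so that it also applies with `f` and `g` exchanged.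
  have hglobal : ∀ f ∈ X, ∀ g ∈ X, (∀ i j : ℤ, 1 ≤ i → f (i, j) = g (i, j)) →
      f (0, j₀) ≠ g (0, j₀) → ∀ i, LinePeriodic f i Q := by
    intro f hf g hg hfg hne
    obtain ⟨-, h1⟩ := hper f hf g hg hfg j₀ hne
    have hright : ∀ n : ℕ, LinePeriodic f (n + 1) Q := by
      intro n
      induction n using Nat.strong_induction_on with
      | _ n ih =>
        rcases Nat.lt_or_ge n N with hlt | hge
        · exact h1 N (n + 1) (by omega) (by omega)
        · intro j
          have := hdet _ (hX (0, Q) f hf) _ hf (n - N + 1) (n - N + 1) (by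
            intro i j hi hi'
            have := ih (n - N + i.toNat) (by omega) j
            simp only [shift, Prod.mk_add_mk, add_zero]
            have e : (n : ℤ) - N + 1 + i = ((n - N + i.toNat : ℕ) : ℤ) + 1 := by omega
            rw [e]
            exact this) j
          simp only [shift, Prod.mk_add_mk, add_zero] at this
          have e : (n : ℤ) - N + 1 + N = n + 1 := by ring
          rwa [e] at this
    -- If line `i` were the first without period `Q`, then `f` and its translate by (0, Q) would
    -- first differ there. `hper` would give that line the period `K`, a divisor of `Q`.
    have hleft : ∀ n : ℕ, ∀ i : ℤ, 1 - (n : ℤ) ≤ i → LinePeriodic f i Q := by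
      intro n
      induction n with
      | zero =>
        intro i hi
        have := hright (i - 1).toNat
        rwa [show ((i - 1).toNat : ℤ) + 1 = i by push_cast at hi; omega] at this
      | succ n ih =>
        intro i hi
        rcases le_or_gt (1 - (n : ℤ)) i with h2 | h2
        · exact ih i h2
        by_contra hcon
        have hex : ∃ j, f (i, j + (Q : ℕ)) ≠ f (i, j) := by
          by_contra! hall
          exact hcon hall
        obtain ⟨j, hj⟩ := hex
        obtain ⟨h3, -⟩ := hper _ (hX (i, 0) f hf) _ (hX (i, Q) f hf) (by
          intro i' j' hi'
          simp only [shift, Prod.mk_add_mk, add_zero]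
          exact (ih _ (by push_cast at hi; omega) _).symm) j (by
          simp only [shift, Prod.mk_add_mk, add_zero, zero_add]
          exact hj.symm)
        apply hj
        have h4 := h3.of_dvd hKQ j
        simpa only [shift, Prod.mk_add_mk, add_zero, zero_add] using h4
    exact fun i => hleft (1 - i).toNat i (by omega)
  have hfper := hglobal f hf g hg hfg hne
  have hgper := hglobal g hg f hf (fun i j hi => (hfg i j hi).symm) (Ne.symm hne)
  -- The state records one vertical period of N + 1 consecutive lines, for `f` and `g` jointly, so
  -- that both receive the same horizontal period.
  set σ : ℤ → (Fin (N + 1) → Fin Q → A × A) := fun x k r =>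
    (f (x + (k : ℕ), (r : ℕ)), g (x + (k : ℕ), (r : ℕ))) with hσ
  have hline : ∀ f' : ℤ × ℤ → A, (∀ i, LinePeriodic f' i Q) → ∀ x x' : ℤ,
      (∀ r : Fin Q, f' (x, (r : ℕ)) = f' (x', (r : ℕ))) → ∀ j, f' (x, j) = f' (x', j) := by
    intro f' hf' x x' hr j
    have hQ' : (Q : ℤ) ≠ 0 := by exact_mod_cast hQpos.ne'
    have hj0 := Int.emod_nonneg j hQ'
    have hj1 := Int.emod_lt_of_pos j (by exact_mod_cast hQpos : (0 : ℤ) < Q)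
    have hd : (Q : ℤ) ∣ j - j % Q := Int.dvd_self_sub_emod
    rw [(hf' x).eq_of_dvd hd, (hf' x').eq_of_dvd hd]
    have := hr ⟨(j % Q).toNat, by omega⟩
    simp only at this
    rwa [Int.toNat_of_nonneg hj0] at this
  have hstep : ∀ x x', σ x = σ x' → σ (x + 1) = σ (x' + 1) := by
    intro x x' hxx
    have hk : ∀ k : ℕ, k < N + 1 → ∀ r : Fin Q, f (x + k, (r : ℕ)) = f (x' + k, (r : ℕ)) ∧
        g (x + k, (r : ℕ)) = g (x' + k, (r : ℕ)) := by
      intro k hk r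
      have := congrFun (congrFun hxx ⟨k, hk⟩) r
      simpa only [hσ, Prod.mk.injEq] using this
    have hnext : ∀ f' ∈ X, (∀ k : ℕ, k < N + 1 → ∀ j, f' (x + k, j) = f' (x' + k, j)) →
        ∀ k : ℕ, k < N + 1 → ∀ j, f' (x + 1 + k, j) = f' (x' + 1 + k, j) := by
      intro f' hf' hkk k hk j
      rcases Nat.lt_or_ge k N with hlt | hge
      · have := hkk (k + 1) (by omega) j
        push_cast at this
        convert this using 3 <;> ring
      · obtain rfl : k = N := by omega
        refine hdet f' hf' f' hf' (x + 1) (x' + 1) ?_ j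
        intro i j hi hi'
        have := hkk (i.toNat + 1) (by omega) j
        push_cast at this
        rw [Int.toNat_of_nonneg hi] at this
        convert this using 3 <;> ring
    have hf1 := hnext f hf fun k hk' => hline f hfper _ _ fun r => (hk k hk' r).1
    have hg1 := hnext g hg fun k hk' => hline g hgper _ _ fun r => (hk k hk' r).2
    funext k r
    simp only [hσ, Prod.mk.injEq]
    exact ⟨hf1 k k.2 _, hg1 k k.2 _⟩
  have hperσ := periodic_of_deterministic σ hstep (le_refl _) 0
  set L := (Nat.card (Fin (N + 1) → Fin Q → A × A)).factorial
  have hL : 1 ≤ L := Nat.factorial_pos _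
  have hall : ∀ r : Fin Q, f (0, (r : ℕ)) = g (0, (r : ℕ)) := by
    intro r
    have h0 := congrFun (congrFun hperσ ⟨0, by omega⟩) r
    simp only [hσ, Prod.mk.injEq, Nat.cast_zero, add_zero, zero_add] at h0
    rw [← h0.1, ← h0.2]
    exact hfg _ _ (by exact_mod_cast hL)
  apply hne
  have hQ' : (Q : ℤ) ≠ 0 := by exact_mod_cast hQpos.ne'
  have hj0 := Int.emod_nonneg j₀ hQ'
  have hj1 := Int.emod_lt_of_pos j₀ (by exact_mod_cast hQpos : (0 : ℤ) < Q)
  have hd : (Q : ℤ) ∣ j₀ - j₀ % Q := Int.dvd_self_sub_emod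
  rw [(hfper 0).eq_of_dvd hd, (hgper 0).eq_of_dvd hd]
  have := hall ⟨(j₀ % Q).toNat, by omega⟩
  simp only at this
  rwa [Int.toNat_of_nonneg hj0] at this

end Core

/-! ### Half-planes, determinism and compactness in the orbit closure -/

section OrbitClosure

variable {A : Type*}

theorem shift_shift (u u' : ℤ × ℤ) (f : ℤ × ℤ → A) : shift u (shift u' f) = shift (u + u') f := by
  funext x
  simp only [shift]
  rw [add_assoc]

variable [TopologicalSpace A] {η : ℤ × ℤ → A}

theorem continuous_shift (u : ℤ × ℤ) : Continuous (shift u : (ℤ × ℤ → A) → ℤ × ℤ → A) :=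
  continuous_pi fun x => continuous_apply (x + u)

theorem shift_mem_orbitClosure (u : ℤ × ℤ) {f : ℤ × ℤ → A} (hf : f ∈ orbitClosure η) :
    shift u f ∈ orbitClosure η := by
  refine map_mem_closure (continuous_shift u) hf ?_
  rintro _ ⟨u', rfl⟩
  exact ⟨u + u', (shift_shift _ _ _).symm⟩

theorem self_mem_orbitClosure : η ∈ orbitClosure η :=
  subset_closure ⟨0, by funext x; simp [shift]⟩

theorem cross_toPlane_add (d : ℝ × ℝ) (p q : ℤ × ℤ) :
    cross d (toPlane (p + q)) = cross d (toPlane p) + cross d (toPlane q) := by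
  simp only [cross, toPlane, Prod.fst_add, Prod.snd_add]
  push_cast
  ring

theorem cross_toPlane_sub (d : ℝ × ℝ) (p q : ℤ × ℤ) :
    cross d (toPlane (p - q)) = cross d (toPlane p) - cross d (toPlane q) := by
  simp only [cross, toPlane, Prod.fst_sub, Prod.snd_sub]
  push_cast
  ring

/-- As `S` is finite, its other points exceed the minimum at `x` by a fixed ε. Each use of
determinism at translates of `x` thus pushes the half-plane of agreement outwards by ε. -/
theorem eq_of_determined_minimum {d : ℝ × ℝ} {S : Set (ℤ × ℤ)} (hS : S.Finite) {x : ℤ × ℤ}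
    (hmin : ∀ p ∈ S, p ≠ x → cross d (toPlane x) < cross d (toPlane p))
    (hgen : ∀ f ∈ orbitClosure η, ∀ g ∈ orbitClosure η, Set.EqOn f g (S \ {x}) → f x = g x)
    {f g : ℤ × ℤ → A} (hf : f ∈ orbitClosure η) (hg : g ∈ orbitClosure η)
    (hfg : ∀ p, 0 ≤ cross d (toPlane p) → f p = g p) : f = g := by
  obtain ⟨ε, hε, hle⟩ : ∃ ε : ℝ, 0 < ε ∧
      ∀ p ∈ S \ {x}, cross d (toPlane x) + ε ≤ cross d (toPlane p) := by
    rcases (S \ {x}).eq_empty_or_nonempty with h | h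
    · exact ⟨1, one_pos, by simp [h]⟩
    · obtain ⟨y, hy, hymin⟩ := Set.exists_min_image _ (fun p => cross d (toPlane p))
        (hS.subset Set.sdiff_subset) h
      exact ⟨cross d (toPlane y) - cross d (toPlane x), sub_pos.2 (hmin y hy.1 hy.2),
        fun p hp => by linarith [hymin p hp]⟩
  have hind : ∀ n : ℕ, ∀ p, -(n * ε) ≤ cross d (toPlane p) → f p = g p := by
    intro n
    induction n with
    | zero => intro p hp; exact hfg p (by simpa using hp)
    | succ n ih =>
      intro p hp
      have := hgen _ (shift_mem_orbitClosure (p - x) hf) _ (shift_mem_orbitClosure (p - x) hg) (by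
        intro r hr
        apply ih
        have h1 := hle r hr
        rw [cross_toPlane_add, cross_toPlane_sub]
        push_cast at hp
        linarith)
      simpa [shift] using this
  funext p
  obtain ⟨n, hn⟩ := exists_nat_ge (-cross d (toPlane p) / ε)
  refine hind n p ?_
  rw [div_le_iff₀ hε] at hn
  linarith

/-- Among the upper level sets of `R` with at most as many patterns as points, take the one with the
highest threshold, attained at `x`. By injectivity only `x` leaves when the threshold is passed. The
rest `F` has at least |F| + 1 patterns, so adding `x` creates none and `x` is determined by `F`. -/
theorem eq_of_injOn [Finite A] {d : ℝ × ℝ} {R : Finset (ℤ × ℤ)}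
    (hR : patternCount (orbitClosure η) R ≤ R.card)
    (hinj : Set.InjOn (fun p => cross d (toPlane p)) R)
    {f g : ℤ × ℤ → A} (hf : f ∈ orbitClosure η) (hg : g ∈ orbitClosure η)
    (hfg : ∀ p, 0 ≤ cross d (toPlane p) → f p = g p) : f = g := by
  classical
  set φ : ℤ × ℤ → ℝ := fun p => cross d (toPlane p) with hφ
  set X := orbitClosure η
  have hne : X.Nonempty := ⟨f, hf⟩
  have hRne : R.Nonempty := by
    rw [Finset.nonempty_iff_ne_empty]
    rintro rfl
    rw [patternCount_empty hne] at hR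
    simp at hR
  set B := R.filter fun x => patternCount X (R.filter fun p => φ x ≤ φ p) ≤
    (R.filter fun p => φ x ≤ φ p).card with hB
  have hBne : B.Nonempty := by
    obtain ⟨x, hx, hxmin⟩ := R.exists_min_image φ hRne
    refine ⟨x, Finset.mem_filter.2 ⟨hx, ?_⟩⟩
    rwa [Finset.filter_true_of_mem hxmin]
  obtain ⟨x, hx, hxmax⟩ := B.exists_max_image φ hBne
  obtain ⟨hxR, hxc⟩ := Finset.mem_filter.1 hx
  set F := R.filter fun p => φ x < φ p with hF
  have hFc : F.card + 1 ≤ patternCount X F := by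
    rcases F.eq_empty_or_nonempty with h | h
    · rw [h, patternCount_empty hne]; simp
    · obtain ⟨y, hy, hymin⟩ := F.exists_min_image φ h
      obtain ⟨hyR, hxy⟩ := Finset.mem_filter.1 hy
      have hFy : (R.filter fun p => φ y ≤ φ p) = F := by
        ext p
        simp only [hF, Finset.mem_filter]
        constructor
        · rintro ⟨h1, h2⟩; exact ⟨h1, hxy.trans_le h2⟩
        · rintro ⟨h1, h2⟩; exact ⟨h1, hymin p (Finset.mem_filter.2 ⟨h1, h2⟩)⟩
      by_contra hcon
      have hyB : y ∈ B := by
        rw [hB, Finset.mem_filter, hFy]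
        exact ⟨hyR, by omega⟩
      exact absurd (hxmax y hyB) (not_le.2 hxy)
  have hins : (R.filter fun p => φ x ≤ φ p) = insert x F := by
    ext p
    simp only [hF, Finset.mem_filter, Finset.mem_insert]
    constructor
    · rintro ⟨h1, h2⟩
      rcases h2.eq_or_lt with h3 | h3
      · exact Or.inl (hinj hxR h1 h3).symm
      · exact Or.inr ⟨h1, h3⟩
    · rintro (rfl | ⟨h1, h2⟩)
      · exact ⟨hxR, le_rfl⟩
      · exact ⟨h1, h2.le⟩
  have hxF : x ∉ F := by simp [hF]
  rw [hins, Finset.card_insert_of_notMem hxF] at hxc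
  refine eq_of_determined_minimum (d := d) (S := (insert x F : Finset (ℤ × ℤ))) (x := x)
    (Finset.finite_toSet _) ?_ ?_ hf hg hfg
  · intro p hp hpx
    rw [Finset.mem_coe, Finset.mem_insert] at hp
    rcases hp with hp | hp
    · exact absurd hp hpx
    · exact (Finset.mem_filter.1 hp).2
  · intro f hf g hg hfg
    refine eqOn_of_patternCount_le (Finset.subset_insert x F) (hxc.trans hFc) hf hg ?_
      (Finset.mem_coe.2 (Finset.mem_insert_self _ _))
    intro p hp
    refine hfg ⟨Finset.mem_coe.2 (Finset.mem_insert_of_mem hp), ?_⟩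
    rintro rfl
    exact hxF hp

variable [DiscreteTopology A]

theorem exists_shift_eqOn {f : ℤ × ℤ → A} (hf : f ∈ orbitClosure η) {S : Set (ℤ × ℤ)}
    (hS : S.Finite) : ∃ u, Set.EqOn (shift u η) f S := by
  have hopen : IsOpen (⋂ p ∈ S, (fun g : ℤ × ℤ → A => g p) ⁻¹' {f p}) :=
    hS.isOpen_biInter fun p _ => (isOpen_discrete _).preimage (continuous_apply p)
  obtain ⟨g, hg, u, rfl⟩ := mem_closure_iff.1 hf _ hopen (by simp)
  exact ⟨u, fun p hp => Set.mem_iInter₂.1 hg p hp⟩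

theorem patternCount_orbitClosure (T : Finset (ℤ × ℤ)) :
    patternCount (orbitClosure η) T = complexity η T := by
  have : patterns (orbitClosure η) T = words η (T : Set (ℤ × ℤ)) := by
    ext w
    constructor
    · rintro ⟨f, hf, rfl⟩
      obtain ⟨u, hu⟩ := exists_shift_eqOn hf T.finite_toSet
      exact ⟨u, pattern_eq_iff.2 hu⟩
    · rintro ⟨u, rfl⟩
      exact ⟨shift u η, subset_closure ⟨u, rfl⟩, rfl⟩
  unfold patternCount complexity
  rw [this]

theorem IsGeneratedBy.eq_of_eqOn {S : Set (ℤ × ℤ)} {x : ℤ × ℤ} (h : IsGeneratedBy η S x)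
    (hS : S.Finite) {f g : ℤ × ℤ → A} (hf : f ∈ orbitClosure η) (hg : g ∈ orbitClosure η)
    (hfg : Set.EqOn f g (S \ {x})) : f x = g x := by
  obtain ⟨u, hu⟩ := exists_shift_eqOn hf hS
  have := h.2 u g hg (fun p hp => (hu hp.1).trans (hfg hp)) h.1
  rw [← hu h.1, this]

/-- If two elements of the orbit closure that agree on a half-plane are equal, then finitely many
consecutive lines determine the next line. -/
theorem exists_strip_determines [Finite A] {v w : ℤ × ℤ} (hvw : v.1 * w.2 - v.2 * w.1 = 1)
    (hexp : ∀ f ∈ orbitClosure η, ∀ g ∈ orbitClosure η,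
      (∀ p : ℤ × ℤ, v.1 * p.2 - v.2 * p.1 ≤ 0 → f p = g p) → f = g) :
    ∃ N : ℕ, ∀ f ∈ orbitClosure η, ∀ g ∈ orbitClosure η,
      (∀ p : ℤ × ℤ, -(N : ℤ) ≤ v.1 * p.2 - v.2 * p.1 → v.1 * p.2 - v.2 * p.1 < 0 → f p = g p) →
      ∀ p : ℤ × ℤ, v.1 * p.2 - v.2 * p.1 = 0 → f p = g p := by
  by_contra! hcon
  set X := orbitClosure η
  have hXc : IsClosed X := isClosed_closure
  have hadd : ∀ p q : ℤ × ℤ, v.1 * (p + q).2 - v.2 * (p + q).1 =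
      (v.1 * p.2 - v.2 * p.1) + (v.1 * q.2 - v.2 * q.1) := by
    intro p q
    simp only [Prod.fst_add, Prod.snd_add]
    ring
  -- Counterexamples for width `N`, translated so that the disagreement is at 0. They form a
  -- decreasing sequence of nonempty compact sets.
  set B : ℕ → Set ((ℤ × ℤ → A) × (ℤ × ℤ → A)) := fun N =>
    {c | (c.1 ∈ X ∧ c.2 ∈ X) ∧ c.1 0 ≠ c.2 0 ∧ ∀ p : ℤ × ℤ, -(N : ℤ) ≤ v.1 * p.2 - v.2 * p.1 →
      v.1 * p.2 - v.2 * p.1 < 0 → c.1 p = c.2 p} with hB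
  have hclopen : ∀ p : ℤ × ℤ, IsClopen {c : (ℤ × ℤ → A) × (ℤ × ℤ → A) | c.1 p = c.2 p} := by
    intro p
    have hc : Continuous fun c : (ℤ × ℤ → A) × (ℤ × ℤ → A) => (c.1 p, c.2 p) := by fun_prop
    exact (isClopen_discrete {a : A × A | a.1 = a.2}).preimage hc
  have hclosed : ∀ N, IsClosed (B N) := by
    intro N
    refine IsClosed.inter ((hXc.preimage continuous_fst).inter (hXc.preimage continuous_snd)) ?_
    refine IsClosed.inter (hclopen 0).compl.isClosed ?_
    have hset : {c : (ℤ × ℤ → A) × (ℤ × ℤ → A) | ∀ p : ℤ × ℤ, -(N : ℤ) ≤ v.1 * p.2 - v.2 * p.1 →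
        v.1 * p.2 - v.2 * p.1 < 0 → c.1 p = c.2 p} =
        ⋂ p : ℤ × ℤ, ⋂ _ : -(N : ℤ) ≤ v.1 * p.2 - v.2 * p.1, ⋂ _ : v.1 * p.2 - v.2 * p.1 < 0,
          {c | c.1 p = c.2 p} := by
      ext c
      simp
    change IsClosed {c : (ℤ × ℤ → A) × (ℤ × ℤ → A) | _}
    rw [hset]
    exact isClosed_iInter fun p => isClosed_iInter fun _ => isClosed_iInter fun _ =>
      (hclopen p).isClosed
  have hmono : ∀ N, B (N + 1) ⊆ B N := by
    rintro N c ⟨h1, h2, h3⟩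
    exact ⟨h1, h2, fun p hp hp' => h3 p (by push_cast; omega) hp'⟩
  have hnon : ∀ N, (B N).Nonempty := by
    intro N
    obtain ⟨f, hf, g, hg, h1, p, hp, hne⟩ := hcon N
    refine ⟨(shift p f, shift p g),
      ⟨shift_mem_orbitClosure p hf, shift_mem_orbitClosure p hg⟩, ?_, ?_⟩
    · simpa [shift] using hne
    · intro r hr hr'
      exact h1 _ (by rw [hadd, hp]; omega) (by rw [hadd, hp]; omega)
  obtain ⟨⟨f, g⟩, hc⟩ := IsCompact.nonempty_iInter_of_sequence_nonempty_isCompact_isClosed B hmono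
    hnon (hclosed 0).isCompact hclosed
  rw [Set.mem_iInter] at hc
  obtain ⟨⟨hf, hg⟩, h0, -⟩ := hc 0
  -- The limit pair agrees on the lines of index < 0, but `hexp` needs index ≤ 0. The vector `w` has
  -- index 1, and translating by it makes up the difference.
  have heq := hexp _ (shift_mem_orbitClosure (-w) hf) _ (shift_mem_orbitClosure (-w) hg) (by
    intro p hp
    refine (hc (-(v.1 * (p + -w).2 - v.2 * (p + -w).1)).toNat).2.2 _ ?_ ?_
    · omega
    · rw [hadd]
      simp only [Prod.fst_neg, Prod.snd_neg]
      linarith)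
  apply h0
  have := congrFun heq w
  simpa [shift] using this

end OrbitClosure

/-! ### Unimodular changes of coordinates -/

section Coordinates

variable {A : Type*}

/-- The linear map that sends `(i, j)` to `i • w + j • v`. -/
def coordinates (v w : ℤ × ℤ) (p : ℤ × ℤ) : ℤ × ℤ :=
  (p.1 * w.1 + p.2 * v.1, p.1 * w.2 + p.2 * v.2)

theorem coordinates_add (v w p q : ℤ × ℤ) :
    coordinates v w (p + q) = coordinates v w p + coordinates v w q := by
  ext <;> simp only [coordinates, Prod.fst_add, Prod.snd_add] <;> ring

theorem line_coordinates {v w : ℤ × ℤ} (hvw : v.1 * w.2 - v.2 * w.1 = 1) (p : ℤ × ℤ) :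
    v.1 * (coordinates v w p).2 - v.2 * (coordinates v w p).1 = p.1 := by
  simp only [coordinates]
  linear_combination p.1 * hvw

theorem coordinates_inverse {v w : ℤ × ℤ} (hvw : v.1 * w.2 - v.2 * w.1 = 1) (x : ℤ × ℤ) :
    coordinates v w (v.1 * x.2 - v.2 * x.1, x.1 * w.2 - x.2 * w.1) = x := by
  ext
  · simp only [coordinates]
    linear_combination x.1 * hvw
  · simp only [coordinates]
    linear_combination x.2 * hvw

theorem shift_comp_coordinates (v w u : ℤ × ℤ) (f : ℤ × ℤ → A) :
    shift u (f ∘ coordinates v w) = shift (coordinates v w u) f ∘ coordinates v w := by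
  funext x
  simp only [shift, Function.comp, coordinates_add]

theorem patternCount_comp_le [Finite A] (X : Set (ℤ × ℤ → A)) (e : ℤ × ℤ → ℤ × ℤ)
    {T T' : Finset (ℤ × ℤ)} (h : ∀ p ∈ T', e p ∈ T) :
    patternCount ((fun f => f ∘ e) '' X) T' ≤ patternCount X T := by
  have : patterns ((fun f => f ∘ e) '' X) T' =
      (fun (w : T → A) (p : T') => w ⟨e p, h p p.2⟩) '' patterns X T := by
    simp only [patterns, Set.image_image]
    rfl
  unfold patternCount
  rw [this]
  exact Set.ncard_image_le (Set.toFinite _)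

end Coordinates

/-! ### Sections of the rectangle of height three by lattice lines -/

section Sections

theorem sum_nonneg_of_reflect {t : ℤ → ℤ} {a b : ℤ}
    (h : ∀ i, a ≤ i → i ≤ b → 0 ≤ t i + t (a + b - i)) : 0 ≤ ∑ i ∈ Finset.Icc a b, t i := by
  have h1 : ∑ i ∈ Finset.Icc a b, t (a + b - i) = ∑ i ∈ Finset.Icc a b, t i := by
    refine Finset.sum_nbij' (fun i => a + b - i) (fun i => a + b - i) ?_ ?_ ?_ ?_ ?_
    · intro i hi; rw [Finset.mem_Icc] at hi ⊢; omega
    · intro i hi; rw [Finset.mem_Icc] at hi ⊢; omega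
    · intro i _; ring
    · intro i _; ring
    · intro i _; rfl
  have h2 : 0 ≤ ∑ i ∈ Finset.Icc a b, (t i + t (a + b - i)) :=
    Finset.sum_nonneg fun i hi => by
      rw [Finset.mem_Icc] at hi
      exact h i hi.1 hi.2
  rw [Finset.sum_add_distrib, h1] at h2
  omega

/-- A finite set of integers without gaps contains an interval with as many elements. -/
theorem exists_Ico_subset (B : Finset ℤ)
    (hB : ∀ i ∈ B, ∀ k ∈ B, ∀ j, i ≤ j → j ≤ k → j ∈ B) :
    ∃ lo : ℤ, ∀ j, lo ≤ j → j < lo + B.card → j ∈ B := by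
  rcases B.eq_empty_or_nonempty with rfl | h
  · exact ⟨0, fun j h1 h2 => by simp at h2; omega⟩
  · refine ⟨B.min' h, fun j h1 h2 => ?_⟩
    have hsub : B ⊆ Finset.Icc (B.min' h) (B.max' h) := fun x hx =>
      Finset.mem_Icc.2 ⟨B.min'_le x hx, B.le_max' x hx⟩
    have hc := Finset.card_le_card hsub
    rw [Int.card_Icc] at hc
    have hle := B.min'_le_max' h
    exact hB _ (B.min'_mem h) _ (B.max'_mem h) j h1 (by omega)

theorem mem_rect {n k : ℕ} {p : ℤ × ℤ} :
    p ∈ rect n k ↔ (0 ≤ p.1 ∧ p.1 < n) ∧ 0 ≤ p.2 ∧ p.2 < k := by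
  rw [rect, Finset.mem_product, Finset.mem_Ico, Finset.mem_Ico]

theorem card_rect (n k : ℕ) : (rect n k).card = n * k := by
  rw [rect, Finset.card_product, Int.card_Ico, Int.card_Ico]
  simp

/-- The number of points of the rectangle of height three on the line of index `i` with direction
`v`. -/
noncomputable def sectionCard (n : ℕ) (v : ℤ × ℤ) (i : ℤ) : ℕ :=
  ((rect n 3).filter fun p => v.1 * p.2 - v.2 * p.1 = i).card

theorem sectionCard_le (n : ℕ) (v : ℤ × ℤ) (i : ℤ) : sectionCard n v i ≤ n * 3 :=
  (Finset.card_filter_le _ _).trans (card_rect n 3).le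

theorem sectionCard_eq (n : ℕ) (v : ℤ × ℤ) (i : ℤ) : sectionCard n v i =
    ((Finset.Ico (0 : ℤ) n).filter fun x => - v.2 * x = i).card +
    ((Finset.Ico (0 : ℤ) n).filter fun x => v.1 - v.2 * x = i).card +
    ((Finset.Ico (0 : ℤ) n).filter fun x => 2 * v.1 - v.2 * x = i).card := by
  have h1 : sectionCard n v i = ∑ y ∈ Finset.Ico (0 : ℤ) (3 : ℕ),
      (((rect n 3).filter fun p => v.1 * p.2 - v.2 * p.1 = i).filter fun p => p.2 = y).card :=
    Finset.card_eq_sum_card_fiberwise fun p hp => by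
      rw [Finset.mem_coe, Finset.mem_filter, mem_rect] at hp
      rw [Finset.mem_coe, Finset.mem_Ico]
      exact hp.1.2
  have h2 : ∀ y ∈ Finset.Ico (0 : ℤ) (3 : ℕ),
      (((rect n 3).filter fun p => v.1 * p.2 - v.2 * p.1 = i).filter fun p => p.2 = y).card =
      ((Finset.Ico (0 : ℤ) n).filter fun x => v.1 * y - v.2 * x = i).card := by
    intro y hy
    rw [Finset.mem_Ico] at hy
    refine Finset.card_nbij' (fun p => p.1) (fun x => (x, y)) ?_ ?_ ?_ ?_
    · intro p hp
      simp only [Finset.coe_filter, Set.mem_ofPred_eq, Finset.mem_filter, mem_rect,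
        Finset.mem_Ico] at hp ⊢
      obtain ⟨⟨h1, h2⟩, rfl⟩ := hp
      exact ⟨h1.1, h2⟩
    · intro x hx
      simp only [Finset.coe_filter, Set.mem_ofPred_eq, Finset.mem_filter, mem_rect,
        Finset.mem_Ico] at hx ⊢
      exact ⟨⟨⟨hx.1, hy⟩, hx.2⟩, trivial⟩
    · intro p hp
      simp only [Finset.coe_filter, Set.mem_ofPred_eq, Finset.mem_filter] at hp
      ext <;> simp [hp.2]
    · intro x _
      rfl
  rw [h1, Finset.sum_congr rfl h2]
  have h3 : Finset.Ico (0 : ℤ) (3 : ℕ) = {0, 1, 2} := by decide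
  rw [h3, Finset.sum_insert (by simp), Finset.sum_insert (by simp), Finset.sum_singleton]
  simp only [mul_zero, mul_one, zero_sub, neg_mul, mul_comm v.1 2, add_assoc]

theorem card_filter_eq_ite {I : Finset ℤ} {P : ℤ → Prop} [DecidablePred P] {c : Prop} [Decidable c]
    {a : ℤ} (h1 : c → a ∈ I ∧ P a) (h2 : ∀ x ∈ I, P x → c ∧ x = a) :
    (I.filter P).card = if c then 1 else 0 := by
  split_ifs with hc
  · rw [Finset.card_eq_one]
    refine ⟨a, ?_⟩
    ext x
    simp only [Finset.mem_filter, Finset.mem_singleton]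
    exact ⟨fun h => (h2 x h.1 h.2).2, fun h => h ▸ h1 hc⟩
  · rw [Finset.card_eq_zero, Finset.filter_eq_empty_iff]
    exact fun x hx hP => hc (h2 x hx hP).1

/-- `τ` is the least index on the bottom row. Each row covers an interval of `n` indices, and going
up a row moves it by `v.1`. -/
theorem sectionCard_one {n : ℕ} {v : ℤ × ℤ} (hv : v.2 = 1 ∨ v.2 = -1) :
    ∃ τ : ℤ, (v.2 = 1 ∧ τ = -(n - 1) ∨ v.2 = -1 ∧ τ = 0) ∧ ∀ i, sectionCard n v i =
      (if 0 ≤ i - τ ∧ i - τ < n then 1 else 0) +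
      (if 0 ≤ i - τ - v.1 ∧ i - τ - v.1 < n then 1 else 0) +
      (if 0 ≤ i - τ - 2 * v.1 ∧ i - τ - 2 * v.1 < n then 1 else 0) := by
  rcases hv with hv | hv
  · refine ⟨-(n - 1), Or.inl ⟨hv, rfl⟩, fun i => ?_⟩
    rw [sectionCard_eq, hv]
    congr 1
    · congr 1
      · exact card_filter_eq_ite (a := -i) (by rw [Finset.mem_Ico]; omega)
          (by intro x hx; rw [Finset.mem_Ico] at hx; omega)
      · exact card_filter_eq_ite (a := v.1 - i) (by rw [Finset.mem_Ico]; omega)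
          (by intro x hx; rw [Finset.mem_Ico] at hx; omega)
    · exact card_filter_eq_ite (a := 2 * v.1 - i) (by rw [Finset.mem_Ico]; omega)
          (by intro x hx; rw [Finset.mem_Ico] at hx; omega)
  · refine ⟨0, Or.inr ⟨hv, rfl⟩, fun i => ?_⟩
    rw [sectionCard_eq, hv]
    congr 1
    · congr 1
      · exact card_filter_eq_ite (a := i) (by rw [Finset.mem_Ico]; omega)
          (by intro x hx; rw [Finset.mem_Ico] at hx; omega)
      · exact card_filter_eq_ite (a := i - v.1) (by rw [Finset.mem_Ico]; omega)
          (by intro x hx; rw [Finset.mem_Ico] at hx; omega)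
    · exact card_filter_eq_ite (a := i - 2 * v.1) (by rw [Finset.mem_Ico]; omega)
          (by intro x hx; rw [Finset.mem_Ico] at hx; omega)

/-- The indicator of the even numbers in `[0, 2 m]`. -/
def evenIndicator (m d : ℤ) : ℕ := if 0 ≤ d ∧ d ≤ 2 * m ∧ d % 2 = 0 then 1 else 0

theorem sectionCard_two {n : ℕ} {v : ℤ × ℤ} (hv : v.2 = 2 ∨ v.2 = -2) :
    ∃ τ : ℤ, (v.2 = 2 ∧ τ = -(2 * (n - 1)) ∨ v.2 = -2 ∧ τ = 0) ∧ ∀ i,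
      sectionCard n v i = evenIndicator (n - 1) (i - τ) +
      evenIndicator (n - 1) (i - τ - v.1) + evenIndicator (n - 1) (i - τ - 2 * v.1) := by
  simp only [evenIndicator]
  rcases hv with hv | hv
  · refine ⟨-(2 * (n - 1)), Or.inl ⟨hv, rfl⟩, fun i => ?_⟩
    rw [sectionCard_eq, hv]
    congr 1
    · congr 1
      · exact card_filter_eq_ite (a := -i / 2) (by rw [Finset.mem_Ico]; omega)
          (by intro x hx; rw [Finset.mem_Ico] at hx; omega)
      · exact card_filter_eq_ite (a := (v.1 - i) / 2) (by rw [Finset.mem_Ico]; omega)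
          (by intro x hx; rw [Finset.mem_Ico] at hx; omega)
    · exact card_filter_eq_ite (a := (2 * v.1 - i) / 2) (by rw [Finset.mem_Ico]; omega)
          (by intro x hx; rw [Finset.mem_Ico] at hx; omega)
  · refine ⟨0, Or.inr ⟨hv, rfl⟩, fun i => ?_⟩
    rw [sectionCard_eq, hv]
    congr 1
    · congr 1
      · exact card_filter_eq_ite (a := i / 2) (by rw [Finset.mem_Ico]; omega)
          (by intro x hx; rw [Finset.mem_Ico] at hx; omega)
      · exact card_filter_eq_ite (a := (i - v.1) / 2) (by rw [Finset.mem_Ico]; omega)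
          (by intro x hx; rw [Finset.mem_Ico] at hx; omega)
    · exact card_filter_eq_ite (a := (i - 2 * v.1) / 2) (by rw [Finset.mem_Ico]; omega)
          (by intro x hx; rw [Finset.mem_Ico] at hx; omega)

/-- The conditions on the sections of a shape in `IsReversingShape`. -/
def GoodSections (s : ℤ → ℕ) (I₀ I₁ : ℤ) : Prop :=
  ((∀ a i, I₀ ≤ a → a ≤ I₁ → I₀ ≤ i → i ≤ I₁ → s a ≤ s i + 1) ∨
    ((∀ a, s a ≤ 3) ∧ (∀ a, s a = 3 → ∀ i, I₀ ≤ i → i ≤ I₁ → 1 ≤ s i))) ∧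
  ∀ Y, 1 ≤ Y → Y ≤ I₁ - I₀ →
    0 ≤ ∑ i ∈ Finset.Icc I₀ (I₁ - Y), if s i = 0 then (0 : ℤ) else s (i + Y) + 1 - s i

theorem goodSections_zero {n : ℕ} (hn : 1 ≤ n) {v : ℤ × ℤ} (hv : v.2 = 0)
    (hv1 : v.1 = 1 ∨ v.1 = -1) :
    GoodSections (sectionCard n v) (min 0 (2 * v.1)) (max 0 (2 * v.1)) := by
  have hs : ∀ i, min 0 (2 * v.1) ≤ i → i ≤ max 0 (2 * v.1) → sectionCard n v i = n := by
    intro i hi hi'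
    have hc : ∀ c : ℤ, ((Finset.Ico (0 : ℤ) n).filter fun _ => c = i).card =
        if c = i then n else 0 := by
      intro c
      split_ifs with h
      · rw [Finset.filter_true_of_mem fun _ _ => h, Int.card_Ico]; simp
      · rw [Finset.filter_false_of_mem fun _ _ => h]; simp
    rw [sectionCard_eq]
    simp only [hv, neg_zero, zero_mul, sub_zero, hc]
    rcases hv1 with h | h <;> rw [h] at hi hi' ⊢ <;> split_ifs <;> omega
  refine ⟨Or.inl fun a i h1 h2 h3 h4 => by rw [hs a h1 h2, hs i h3 h4]; omega,
    fun Y hY _ => Finset.sum_nonneg fun i hi => ?_⟩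
  rw [Finset.mem_Icc] at hi
  rw [hs i (by omega) (by omega), hs (i + Y) (by omega) (by omega), if_neg (by omega)]
  omega

/-- As |α| < n, the three intervals leave no gap, so sections lie between 1 and 3. A half-turn of
the rectangle makes `s` symmetric, and pairing `i` with the reflection of `i + Y` cancels the
differences, leaving 1 + 1. -/
theorem goodSections_one {n : ℕ} {s : ℤ → ℕ} {α τ : ℤ} (hα : |α| ≤ n - 1)
    (hs : ∀ i, s i = (if 0 ≤ i - τ ∧ i - τ < n then 1 else 0) +
      (if 0 ≤ i - τ - α ∧ i - τ - α < n then 1 else 0) +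
      (if 0 ≤ i - τ - 2 * α ∧ i - τ - 2 * α < n then 1 else 0)) :
    GoodSections s (τ + min 0 (2 * α)) (τ + (n - 1) + max 0 (2 * α)) := by
  rw [abs_le] at hα
  have h3 : ∀ i, s i ≤ 3 := by
    intro i
    rw [hs]
    split_ifs <;> omega
  have h1 : ∀ i, τ + min 0 (2 * α) ≤ i → i ≤ τ + (n - 1) + max 0 (2 * α) → 1 ≤ s i := by
    intro i hi hi'
    rw [hs]
    split_ifs <;> omega
  have hsymm : ∀ i, s (2 * τ + 2 * α + (n - 1) - i) = s i := by
    intro i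
    rw [hs, hs]
    rw [add_comm, ← add_assoc, add_right_comm]
    congr 1
    · congr 1
      · exact if_congr (by omega) rfl rfl
      · exact if_congr (by omega) rfl rfl
    · exact if_congr (by omega) rfl rfl
  refine ⟨Or.inr ⟨h3, fun _ _ => h1⟩, fun Y hY hY' => sum_nonneg_of_reflect fun i hi hi' => ?_⟩
  have a1 := h1 i hi (by omega)
  set i' := τ + min 0 (2 * α) + (τ + (n - 1) + max 0 (2 * α) - Y) - i with hi'def
  have a2 := h1 i' (by omega) (by omega)
  rw [if_neg (by omega), if_neg (by omega)]
  have e1 : s i' = s (i + Y) := by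
    rw [← hsymm (i + Y)]; congr 1; omega
  have e2 : s (i' + Y) = s i := by
    rw [← hsymm i]; congr 1; omega
  rw [e1, e2]
  omega

/-- The middle row has indices of the opposite parity to the outer ones, so sections are at most 2.
A negative term is -1: an index `i` on both outer rows with `i + Y` beyond the middle row. Its
partner, the reflection of `i + Y + 1`, lies on the first row only, and after a step `Y` it meets
the middle row, which contributes at least 1. -/
theorem goodSections_two_of_pos {m : ℤ} {s : ℤ → ℕ} {α τ : ℤ} (hα : 1 ≤ α) (hαm : α ≤ m)
    (hodd : α % 2 = 1)
    (hs : ∀ i, s i = evenIndicator m (i - τ) + evenIndicator m (i - τ - α) +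
      evenIndicator m (i - τ - 2 * α)) :
    GoodSections s τ (τ + 2 * m + 2 * α) := by
  have h2 : ∀ i, s i ≤ 2 := by
    intro i
    rw [hs]
    simp only [evenIndicator]
    split_ifs <;> omega
  set t : ℤ → ℤ → ℤ := fun Y i => if s i = 0 then (0 : ℤ) else s (i + Y) + 1 - s i with ht
  have hneg : ∀ Y i, 1 ≤ Y → τ ≤ i → i ≤ τ + 2 * m + 2 * α - Y → t Y i < 0 →
      t Y i = -1 ∧ i < τ + 2 * m + 2 * α - Y ∧ 1 ≤ t Y (2 * τ + 2 * m + 2 * α - Y - 1 - i) := by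
    intro Y i hY hi hi' hlt
    have b1 := h2 i
    have b2 : s i = 2 ∧ s (i + Y) = 0 ∧ t Y i = -1 := by
      simp only [ht] at hlt ⊢
      split_ifs at hlt ⊢ <;> omega
    have b3 : (i - τ) % 2 = 0 ∧ 2 * α ≤ i - τ ∧ i - τ ≤ 2 * m := by
      have := b2.1
      rw [hs] at this
      simp only [evenIndicator] at this
      split_ifs at this <;> omega
    have b4 : (i + Y - τ) % 2 = 1 ∧ 2 * m + α < i + Y - τ := by
      have := b2.2.1
      rw [hs] at this
      simp only [evenIndicator] at this
      split_ifs at this <;> omega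
    refine ⟨b2.2.2, by omega, ?_⟩
    set i' := 2 * τ + 2 * m + 2 * α - Y - 1 - i with hi'def
    have c1 : s i' = 1 := by
      rw [hs]
      simp only [evenIndicator]
      rw [if_pos (by omega), if_neg (by omega), if_neg (by omega)]
    have c2 : 1 ≤ s (i' + Y) := by
      rw [hs]
      simp only [evenIndicator]
      rw [if_pos (show 0 ≤ i' + Y - τ - α ∧ i' + Y - τ - α ≤ 2 * m ∧ (i' + Y - τ - α) % 2 = 0 by
        omega)]
      omega
    simp only [ht]
    rw [if_neg (by omega), c1]
    omega
  refine ⟨Or.inr ⟨fun a => (h2 a).trans (by norm_num), fun a ha => ?_⟩, fun Y hY hY' => ?_⟩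
  · have := h2 a
    omega
  change 0 ≤ ∑ i ∈ Finset.Icc τ (τ + 2 * m + 2 * α - Y), t Y i
  -- The reflection is off center by one, so the last index has no partner; its term is nonnegative
  -- by itself.
  rw [sum_Icc_right (t Y) (by omega)]
  refine add_nonneg ?_ (sum_nonneg_of_reflect fun i hi hi' => ?_)
  · by_contra hcon
    have := (hneg Y _ hY (by omega) le_rfl (not_le.1 hcon)).2.1
    omega
  · set i' := τ + (τ + 2 * m + 2 * α - Y - 1) - i with hi'def
    have e1 : 2 * τ + 2 * m + 2 * α - Y - 1 - i = i' := by omega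
    have e2 : 2 * τ + 2 * m + 2 * α - Y - 1 - i' = i := by omega
    have d1 := hneg Y i hY hi (by omega)
    have d2 := hneg Y i' hY (by omega) (by omega)
    rw [e1] at d1
    rw [e2] at d2
    by_contra hcon
    rcases lt_or_ge (t Y i) 0 with h | h
    · have := d1 h; omega
    · rcases lt_or_ge (t Y i') 0 with h' | h'
      · have := d2 h'; omega
      · omega

theorem goodSections_two {m : ℤ} {s : ℤ → ℕ} {α τ : ℤ} (hαm : |α| ≤ m) (hodd : α % 2 = 1)
    (hs : ∀ i, s i = evenIndicator m (i - τ) + evenIndicator m (i - τ - α) +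
      evenIndicator m (i - τ - 2 * α)) :
    GoodSections s (τ + min 0 (2 * α)) (τ + 2 * m + max 0 (2 * α)) := by
  rw [abs_le] at hαm
  rcases le_or_gt 1 α with h | h
  · have := goodSections_two_of_pos h hαm.2 hodd hs
    rwa [min_eq_left (by omega), max_eq_right (by omega), add_zero]
  -- Negative α is handled by listing the three rows from top to bottom.
  · have := goodSections_two_of_pos (s := s) (α := -α) (τ := τ + 2 * α) (m := m) (by omega)
      (by omega) (by omega) (by
        intro i
        rw [hs, show i - (τ + 2 * α) = i - τ - 2 * α by ring,
          show i - τ - 2 * α - -α = i - τ - α by ring,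
          show i - τ - 2 * α - 2 * -α = i - τ by ring]
        ring)
    rw [min_eq_right (by omega), max_eq_left (by omega)]
    convert this using 1
    ring

theorem exists_goodSections {n : ℕ} (hn : 1 ≤ n) {v w : ℤ × ℤ}
    (hvw : v.1 * w.2 - v.2 * w.1 = 1) (h1 : |v.1| ≤ n - 1) (h2 : |v.2| ≤ 2) :
    ∃ I₀ I₁ : ℤ, GoodSections (sectionCard n v) I₀ I₁ ∧
      ∀ p ∈ rect n 3, I₀ ≤ v.1 * p.2 - v.2 * p.1 ∧ v.1 * p.2 - v.2 * p.1 ≤ I₁ := by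
  have key : ∀ p ∈ rect n 3, (0 ≤ p.1 ∧ p.1 < n) ∧
      (v.1 * p.2 = 0 ∨ v.1 * p.2 = v.1 ∨ v.1 * p.2 = 2 * v.1) := by
    intro p hp
    rw [mem_rect] at hp
    refine ⟨hp.1, ?_⟩
    have : p.2 = 0 ∨ p.2 = 1 ∨ p.2 = 2 := by omega
    rcases this with h | h | h <;> rw [h] <;> omega
  rw [abs_le] at h2
  have h3 : v.2 = 0 ∨ (v.2 = 1 ∨ v.2 = -1) ∨ (v.2 = 2 ∨ v.2 = -2) := by omega
  rcases h3 with hv | hv | hv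
  · rw [hv, zero_mul, sub_zero] at hvw
    refine ⟨_, _, goodSections_zero hn hv (Int.eq_one_or_neg_one_of_mul_eq_one hvw),
      fun p hp => ?_⟩
    have := key p hp
    rw [hv, zero_mul, sub_zero]
    omega
  · obtain ⟨τ, hτ, hs⟩ := sectionCard_one (n := n) hv
    refine ⟨_, _, goodSections_one h1 hs, fun p hp => ?_⟩
    have := key p hp
    rcases hτ with ⟨hv, rfl⟩ | ⟨hv, rfl⟩ <;> rw [hv] <;> omega
  · obtain ⟨τ, hτ, hs⟩ := sectionCard_two (n := n) hv
    have hodd : v.1 % 2 = 1 := by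
      rcases Int.emod_two_eq_zero_or_one v.1 with h | h
      · obtain ⟨k, hk⟩ := Int.dvd_of_emod_eq_zero h
        rw [hk] at hvw
        have : 2 * k * w.2 = 2 * (k * w.2) := by ring
        rcases hv with hv | hv <;> rw [hv] at hvw <;> omega
      · exact h
    refine ⟨_, _, goodSections_two h1 hodd hs, fun p hp => ?_⟩
    have := key p hp
    rcases hτ with ⟨hv, rfl⟩ | ⟨hv, rfl⟩ <;> rw [hv] <;> omega

/-- By convexity each line meets the rectangle in consecutive lattice points, so in the new
coordinates the rectangle is a union of vertical segments. -/
theorem exists_isReversingShape {A : Type*} [Finite A] {X : Set (ℤ × ℤ → A)} {n : ℕ} (hn : 1 ≤ n)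
    {v w : ℤ × ℤ} (hvw : v.1 * w.2 - v.2 * w.1 = 1) (h1 : |v.1| ≤ n - 1) (h2 : |v.2| ≤ 2)
    (hX : patternCount X (rect n 3) ≤ 3 * n) :
    ∃ lo s I₀ I₁ M, IsReversingShape ((fun f => f ∘ coordinates v w) '' X) lo s I₀ I₁ M := by
  obtain ⟨I₀, I₁, hgood, hrange⟩ := exists_goodSections hn hvw h1 h2
  have hlo : ∀ i, ∃ lo : ℤ, ∀ j, lo ≤ j → j < lo + sectionCard n v i →
      coordinates v w (i, j) ∈ rect n 3 := by
    intro i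
    set B := ((rect n 3).filter fun p => v.1 * p.2 - v.2 * p.1 = i).image
      fun x => x.1 * w.2 - x.2 * w.1 with hB
    have hBmem : ∀ j, j ∈ B ↔ coordinates v w (i, j) ∈ rect n 3 := by
      intro j
      rw [hB, Finset.mem_image]
      constructor
      · rintro ⟨x, hx, rfl⟩
        obtain ⟨hx, rfl⟩ := Finset.mem_filter.1 hx
        rwa [coordinates_inverse hvw]
      · intro h
        refine ⟨_, Finset.mem_filter.2 ⟨h, line_coordinates hvw _⟩, ?_⟩
        simp only [coordinates]
        linear_combination j * hvw
    have hcard : B.card = sectionCard n v i := by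
      refine Finset.card_image_of_injOn ?_
      intro x hx y hy hxy
      obtain ⟨-, hx⟩ := Finset.mem_filter.1 hx
      obtain ⟨-, hy⟩ := Finset.mem_filter.1 hy
      simp only at hxy
      rw [← coordinates_inverse hvw x, ← coordinates_inverse hvw y, hx, hy, hxy]
    obtain ⟨lo, hlo⟩ := exists_Ico_subset B (by
      intro a ha b hb j haj hjb
      rw [hBmem, mem_rect] at *
      simp only [coordinates] at *
      have hmono : ∀ c : ℤ, (a * c ≤ j * c ∧ j * c ≤ b * c) ∨ (b * c ≤ j * c ∧ j * c ≤ a * c) := by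
        intro c
        rcases le_total 0 c with hc | hc
        · exact Or.inl ⟨mul_le_mul_of_nonneg_right haj hc, mul_le_mul_of_nonneg_right hjb hc⟩
        · exact Or.inr ⟨mul_le_mul_of_nonpos_right hjb hc, mul_le_mul_of_nonpos_right haj hc⟩
      have m1 := hmono v.1
      have m2 := hmono v.2
      omega)
    rw [hcard] at hlo
    exact ⟨lo, fun j h1 h2 => (hBmem j).1 (hlo j h1 h2)⟩
  choose lo hlo using hlo
  refine ⟨lo, sectionCard n v, I₀, I₁, n * 3, sectionCard_le n v, ?_, hgood.1, hgood.2⟩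
  have hle := patternCount_comp_le X (coordinates v w) (T := rect n 3)
    (T' := region lo (sectionCard n v) I₀ I₁) (by
      intro p hp
      rw [mem_region] at hp
      exact hlo p.1 p.2 hp.2.1 hp.2.2)
  have hsum : (rect n 3).card = ∑ i ∈ Finset.Icc I₀ I₁, sectionCard n v i :=
    Finset.card_eq_sum_card_fiberwise fun p hp =>
      Finset.mem_coe.2 (Finset.mem_Icc.2 (hrange p hp))
  rw [card_rect] at hsum
  omega

end Sections

/-! ### Primitive lattice vectors -/

section Lattice

theorem exists_primitive {d : ℤ × ℤ} (hd : d ≠ 0) :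
    ∃ (v w : ℤ × ℤ) (k : ℕ), 0 < k ∧ v.1 * w.2 - v.2 * w.1 = 1 ∧ d.1 = k * v.1 ∧ d.2 = k * v.2 := by
  have hg : 0 < Int.gcd d.1 d.2 := by
    rw [Int.gcd_pos_iff]
    by_contra! h
    exact hd (Prod.ext h.1 h.2)
  obtain ⟨m, n, hmn, h1, h2⟩ := Int.exists_gcd_one hg
  obtain ⟨a, b, hab⟩ := Int.isCoprime_iff_gcd_eq_one.2 hmn
  exact ⟨(m, n), (-b, a), _, hg, by linear_combination hab, by rw [mul_comm]; exact h1,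
    by rw [mul_comm]; exact h2⟩

theorem toPlane_injective : Function.Injective toPlane := by
  intro p q h
  simp only [toPlane, Prod.mk.injEq, Int.cast_inj] at h
  exact Prod.ext h.1 h.2

end Lattice

/-! ### Vertices and area of a lattice polygon -/

section Vertices

theorem eq_of_cross_eq {d e x y : ℝ × ℝ} (hde : cross d e ≠ 0) (h1 : cross d x = cross d y)
    (h2 : cross e x = cross e y) : x = y := by
  simp only [cross] at *
  ext
  · exact mul_left_cancel₀ hde (by linear_combination e.1 * h1 - d.1 * h2)
  · exact mul_left_cancel₀ hde (by linear_combination e.2 * h1 - d.2 * h2)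

theorem cross_combination (d x y : ℝ × ℝ) (s t : ℝ) :
    cross d (s • x + t • y) = s * cross d x + t * cross d y := by
  simp only [cross, Prod.fst_add, Prod.snd_add, Prod.smul_fst, Prod.smul_snd, smul_eq_mul]
  ring

theorem cross_sub (d x y : ℝ × ℝ) : cross d (x - y) = cross d x - cross d y := by
  simp only [cross, Prod.fst_sub, Prod.snd_sub]
  ring

theorem cross_smul_left (d x : ℝ × ℝ) (t : ℝ) : cross (t • d) x = t * cross d x := by
  simp only [cross, Prod.smul_fst, Prod.smul_snd, smul_eq_mul]
  ring

/-- The lexicographic minimum of a set of lattice points for a pair of linear functionals is a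
vertex. -/
theorem mem_boundaryVertices_of_lexMin {S : Set (ℤ × ℤ)} {d e : ℝ × ℝ} (hde : cross d e ≠ 0)
    {a : ℤ × ℤ} (ha : a ∈ S) (hmin : ∀ p ∈ S, cross d (toPlane a) < cross d (toPlane p) ∨
      cross d (toPlane a) = cross d (toPlane p) ∧ cross e (toPlane a) ≤ cross e (toPlane p)) :
    a ∈ boundaryVertices S := by
  -- The lexicographic half-plane at `a` is convex, hence contains the hull, and has `a` as an
  -- extreme point.
  set K : Set (ℝ × ℝ) := {z | cross d (toPlane a) < cross d z ∨
    cross d (toPlane a) = cross d z ∧ cross e (toPlane a) ≤ cross e z} with hK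
  have hKc : Convex ℝ K := by
    rw [convex_iff_forall_pos]
    intro x hx y hy s t hs ht hst
    have e1 : ∀ c : ℝ, c = s * c + t * c := fun c => by rw [← add_mul, hst, one_mul]
    change _ ∨ _
    rw [cross_combination, cross_combination, e1 (cross d (toPlane a)), e1 (cross e (toPlane a))]
    rcases hx with hx | ⟨hx, hx'⟩ <;> rcases hy with hy | ⟨hy, hy'⟩
    · exact Or.inl (by gcongr)
    · exact Or.inl (by rw [hy]; gcongr; rw [← hy]; exact hx)
    · exact Or.inl (by rw [hx]; gcongr; rw [← hx]; exact hy)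
    · exact Or.inr ⟨by rw [← hx, ← hy], by gcongr⟩
  have hsub : hull S ⊆ K := convexHull_min (by rintro _ ⟨p, hp, rfl⟩; exact hmin p hp) hKc
  refine ⟨ha, subset_convexHull ℝ _ ⟨a, ha, rfl⟩, ?_⟩
  rintro x hx y hy ⟨s, t, hs, ht, hst, hxy⟩
  have f1 := cross_combination d x y s t
  have f2 := cross_combination e x y s t
  rw [hxy] at f1 f2
  have ht' : t = 1 - s := by linarith
  have g : ∀ {c p q : ℝ}, c = s * p + t * q → c ≤ p → c ≤ q → c = p := by
    intro c p q h h1 h2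
    refine le_antisymm h1 (le_of_mul_le_mul_left ?_ hs)
    have := mul_le_mul_of_nonneg_left h2 ht.le
    rw [ht'] at this h
    linarith
  have k1 : ∀ {z}, z ∈ K → cross d (toPlane a) ≤ cross d z := by
    rintro z (h | h)
    · exact h.le
    · exact h.1.le
  have d1 := g f1 (k1 (hsub hx)) (k1 (hsub hy))
  have d2 : cross d (toPlane a) = cross d y := by
    rw [← d1, ht'] at f1
    exact mul_left_cancel₀ ht.ne' (by rw [ht']; linarith)
  have k2 : ∀ {z}, z ∈ K → cross d (toPlane a) = cross d z → cross e (toPlane a) ≤ cross e z := by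
    rintro z (h | h) h'
    · exact absurd h' h.ne
    · exact h.2
  have d3 := g f2 (k2 (hsub hx) d1) (k2 (hsub hy) d2)
  exact (eq_of_cross_eq hde d1 d3).symm

theorem exists_lexMin {S : Set (ℤ × ℤ)} (hS : S.Finite) (hne : S.Nonempty) {d e : ℝ × ℝ}
    (hde : cross d e ≠ 0) : ∃ a ∈ boundaryVertices S, ∀ p ∈ S,
      cross d (toPlane a) < cross d (toPlane p) ∨
      cross d (toPlane a) = cross d (toPlane p) ∧ cross e (toPlane a) ≤ cross e (toPlane p) := by
  obtain ⟨c, hc, hcmin⟩ := Set.exists_min_image S (fun p => cross d (toPlane p)) hS hne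
  obtain ⟨a, ⟨ha, hac⟩, hamin⟩ := Set.exists_min_image
    {p | p ∈ S ∧ cross d (toPlane p) = cross d (toPlane c)} (fun p => cross e (toPlane p))
    (hS.subset fun p hp => hp.1) ⟨c, hc, rfl⟩
  have hmin : ∀ p ∈ S, cross d (toPlane a) < cross d (toPlane p) ∨
      cross d (toPlane a) = cross d (toPlane p) ∧ cross e (toPlane a) ≤ cross e (toPlane p) := by
    intro p hp
    rcases (hcmin p hp).lt_or_eq with h | h
    · exact Or.inl (hac.trans_lt h)
    · exact Or.inr ⟨hac.trans h, hamin p ⟨hp, h.symm⟩⟩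
  exact ⟨a, mem_boundaryVertices_of_lexMin hde ha hmin, hmin⟩

theorem volume_pos_of_triangle {K : Set (ℝ × ℝ)} (hK : Convex ℝ K) {a b c : ℝ × ℝ} (ha : a ∈ K)
    (hb : b ∈ K) (hc : c ∈ K) (h : 0 < cross (b - a) (c - a)) : 0 < MeasureTheory.volume K := by
  set U : Set (ℝ × ℝ) := {q | 0 < cross (b - a) (q - a)} ∩ {q | 0 < cross (c - b) (q - b)} ∩
    {q | 0 < cross (a - c) (q - c)} with hU
  have hUo : IsOpen U := by
    have hopen : ∀ x y : ℝ × ℝ, IsOpen {q | 0 < cross x (q - y)} := fun x y =>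
      isOpen_lt continuous_const (by unfold cross; fun_prop)
    exact ((hopen _ _).inter (hopen _ _)).inter (hopen _ _)
  have hUn : U.Nonempty := by
    refine ⟨((a.1 + b.1 + c.1) / 3, (a.2 + b.2 + c.2) / 3), ⟨?_, ?_⟩, ?_⟩ <;>
      simp only [cross, Prod.fst_sub, Prod.snd_sub, Set.mem_ofPred_eq] at h ⊢ <;> nlinarith
  refine (hUo.measure_pos _ hUn).trans_le (MeasureTheory.measure_mono ?_)
  rintro q ⟨⟨h1, h2⟩, h3⟩
  simp only [Set.mem_ofPred_eq] at h1 h2 h3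
  have hsum : cross (c - b) (q - b) + cross (a - c) (q - c) + cross (b - a) (q - a) =
      cross (b - a) (c - a) := by
    simp only [cross, Prod.fst_sub, Prod.snd_sub]; ring
  set D := cross (b - a) (c - a) with hD
  -- Barycentric coordinates show that the open triangle lies in `K`.
  have hq : q = (cross (c - b) (q - b) / D) • a + (cross (a - c) (q - c) / D) • b +
      (cross (b - a) (q - a) / D) • c := by
    ext <;> simp only [Prod.fst_add, Prod.snd_add, Prod.smul_fst, Prod.smul_snd, smul_eq_mul] <;>
      field_simp <;> simp only [hD, cross, Prod.fst_sub, Prod.snd_sub] <;> ring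
  have hmem := hK.sum_mem (t := Finset.univ)
    (w := ![cross (c - b) (q - b) / D, cross (a - c) (q - c) / D, cross (b - a) (q - a) / D])
    (z := ![a, b, c])
    (by intro i _; fin_cases i <;> simp <;> positivity)
    (by rw [Fin.sum_univ_three]; simp only [Matrix.cons_val]
        rw [← add_div, ← add_div, hsum, div_self h.ne'])
    (by intro i _; fin_cases i <;> simp [ha, hb, hc])
  rw [Fin.sum_univ_three] at hmem
  simp only [Matrix.cons_val] at hmem
  rwa [← hq] at hmem

end Vertices

/-! ### Edges of generating sets and nonexpansive directions -/

section GeneratingSets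

variable {A : Type*} [Finite A] [TopologicalSpace A] [DiscreteTopology A] {η : ℤ × ℤ → A}

/-- Along every line of direction `v`, `m` consecutive letters determine the next. The resulting
period is the same on all these lines, hence a period of `η`. -/
theorem isPeriodic_of_isGeneratedBy_segment {S : Set (ℤ × ℤ)} (hS : S.Finite) {a v : ℤ × ℤ} {m : ℕ}
    (hv : v ≠ 0) (hsub : ∀ p ∈ S, ∃ k : ℕ, k ≤ m ∧ p = a + (k : ℤ) • v)
    (hgen : IsGeneratedBy η S (a + (m : ℤ) • v)) : IsPeriodic η := by
  have hper : ∀ x : ℤ × ℤ, ∀ j : ℤ,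
      η (x + (j + ((1 * Nat.card A ^ m).factorial : ℕ)) • v) = η (x + j • v) := by
    intro x
    refine sequence_periodic (fun j : ℤ => η (x + j • v)) one_pos ?_ le_rfl
    intro i j _ hij
    have key : ∀ i k : ℤ, shift (x + i • v - a) η (a + k • v) = η (x + (i + k) • v) := by
      intro i k
      simp only [shift, add_smul]
      congr 1
      abel
    have := hgen.eq_of_eqOn hS (shift_mem_orbitClosure (x + i • v - a) self_mem_orbitClosure)
      (shift_mem_orbitClosure (x + j • v - a) self_mem_orbitClosure) (by
        rintro p ⟨hp, hpm⟩
        obtain ⟨k, hk, rfl⟩ := hsub p hp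
        rw [key, key]
        refine hij k (lt_of_le_of_ne hk ?_)
        rintro rfl
        exact hpm rfl)
    rwa [key, key] at this
  refine ⟨(((1 * Nat.card A ^ m).factorial : ℕ) : ℤ) • v, ?_, fun x => ?_⟩
  · exact smul_ne_zero (by exact_mod_cast Nat.factorial_ne_zero _) hv
  · simpa using hper x 0

theorem exists_boundaryEdge (haper : ¬ IsPeriodic η) {l : DirectedLine}
    (hl : IsNonexpansiveDirection η l) {S : Set (ℤ × ℤ)} (hS : IsGeneratingSet η S) :
    ∃ w ∈ boundaryEdges S, EdgeParallel w l := by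
  obtain ⟨hne, hfin, -, hgen⟩ := hS
  set d := l.dir with hd
  have hnorm : 0 < d.1 * d.1 + d.2 * d.2 := by
    by_contra! h
    have h1 := mul_self_nonneg d.1
    have h2 := mul_self_nonneg d.2
    exact l.dir_ne_zero (Prod.ext (mul_self_eq_zero.1 (by linarith))
      (mul_self_eq_zero.1 (by linarith)))
  -- With e = (d.2, -d.1), `cross e` is the inner product with `d`. So `a` and `b` are the first and
  -- last points, along `d`, of the face minimizing `cross d`.
  obtain ⟨a, ha, hamin⟩ := exists_lexMin hfin hne (d := d) (e := (d.2, -d.1)) (by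
    simp only [cross]; linarith)
  obtain ⟨b, hb, hbmin⟩ := exists_lexMin hfin hne (d := d) (e := (-d.2, d.1)) (by
    simp only [cross]; linarith)
  have hab : cross d (toPlane a) = cross d (toPlane b) := by
    rcases hamin b hb.1 with h1 | h1
    · rcases hbmin a ha.1 with h2 | h2
      · exact absurd h2 h1.not_gt
      · exact h2.1.symm
    · exact h1.1
  -- Otherwise the minimum on `S` is attained only at a generated vertex, which makes `l` expansive.
  have hne' : a ≠ b := by
    rintro rfl
    obtain ⟨f, hf, g, hg, hfg, heq⟩ := hl
    refine hfg (eq_of_determined_minimum (d := d) hfin (x := a) ?_ ?_ hf hg fun p hp => heq hp)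
    · intro p hp hpa
      rcases hamin p hp with h1 | h1
      · exact h1
      · rcases hbmin p hp with h2 | h2
        · exact h2
        · refine absurd (toPlane_injective (eq_of_cross_eq (d := d) (e := (d.2, -d.1)) ?_ h1.1
            (le_antisymm h1.2 ?_))) (Ne.symm hpa)
          · simp only [cross]; linarith
          · have := h2.2
            simp only [cross] at this ⊢
            linarith
    · intro f hf g hg h
      exact (hgen a ha).eq_of_eqOn hfin hf hg h
  obtain ⟨t, ht⟩ : ∃ t : ℝ, toPlane b - toPlane a = t • d := by
    refine ⟨(d.1 * (toPlane b - toPlane a).1 + d.2 * (toPlane b - toPlane a).2) /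
      (d.1 * d.1 + d.2 * d.2), ?_⟩
    have h0 : cross d (toPlane b - toPlane a) = 0 := by rw [cross_sub, hab, sub_self]
    simp only [cross] at h0
    ext
    · simp only [Prod.smul_fst, smul_eq_mul]
      rw [div_mul_eq_mul_div, eq_div_iff hnorm.ne']
      linear_combination (-d.2) * h0
    · simp only [Prod.smul_snd, smul_eq_mul]
      rw [div_mul_eq_mul_div, eq_div_iff hnorm.ne']
      linear_combination d.1 * h0
  have ht1 : (toPlane b).1 = (toPlane a).1 + t * d.1 := by
    have := congrArg Prod.fst ht
    simp only [Prod.fst_sub, Prod.smul_fst, smul_eq_mul] at this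
    linarith
  have ht2 : (toPlane b).2 = (toPlane a).2 + t * d.2 := by
    have := congrArg Prod.snd ht
    simp only [Prod.snd_sub, Prod.smul_snd, smul_eq_mul] at this
    linarith
  have htpos : 0 < t := by
    have h0 : 0 ≤ t * (d.1 * d.1 + d.2 * d.2) := by
      rcases hamin b hb.1 with h1 | h1
      · exact absurd hab h1.ne
      · have := h1.2
        simp only [cross, ht1, ht2] at this
        linarith
    refine lt_of_le_of_ne (nonneg_of_mul_nonneg_left h0 hnorm) ?_
    rintro rfl
    exact hne' (toPlane_injective (sub_eq_zero.1 (by rw [ht, zero_smul])).symm)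
  have hmin : ∀ p ∈ S, cross d (toPlane a) ≤ cross d (toPlane p) := by
    intro p hp
    rcases hamin p hp with h | h
    · exact h.le
    · exact h.1.le
  have hleft : ∀ q ∈ hull S, 0 ≤ cross (toPlane b - toPlane a) (q - toPlane a) := by
    have hsub : hull S ⊆ {q | 0 ≤ cross (toPlane b - toPlane a) (q - toPlane a)} := by
      refine convexHull_min ?_ ?_
      · rintro _ ⟨p, hp, rfl⟩
        rw [Set.mem_ofPred_eq, ht, cross_smul_left, cross_sub]
        exact mul_nonneg htpos.le (sub_nonneg.2 (hmin p hp))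
      · rw [convex_iff_forall_pos]
        intro x hx y hy s r hs hr hsr
        simp only [Set.mem_ofPred_eq, ht, cross_smul_left] at hx hy ⊢
        rw [cross_sub] at hx hy ⊢
        rw [cross_combination]
        have h1 := mul_nonneg hs.le hx
        have h2 := mul_nonneg hr.le hy
        have h3 : r = 1 - s := by linarith
        rw [h3] at h2 ⊢
        linarith
    exact hsub
  refine ⟨(a, b), ⟨?_, ha, hb, hne', hleft⟩, t, htpos, ht⟩
  by_cases hflat : ∃ c ∈ S, cross d (toPlane a) < cross d (toPlane c)
  · obtain ⟨c, hc, hac⟩ := hflat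
    refine volume_pos_of_triangle (convex_convexHull ℝ _) (subset_convexHull ℝ _ ⟨a, ha.1, rfl⟩)
      (subset_convexHull ℝ _ ⟨b, hb.1, rfl⟩) (subset_convexHull ℝ _ ⟨c, hc, rfl⟩) ?_
    rw [ht, cross_smul_left, cross_sub]
    exact mul_pos htpos (sub_pos.2 hac)
  -- A degenerate `S` lies on the segment from `a` to `b`, and generation of its end point `b`
  -- contradicts aperiodicity.
  · push Not at hflat
    refine absurd ?_ haper
    have hline : ∀ p ∈ S, cross d (toPlane p) = cross d (toPlane a) := fun p hp =>
      le_antisymm (hflat p hp) (hmin p hp)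
    obtain ⟨v, w, k, hk, hvw, hv1, hv2⟩ := exists_primitive (d := b - a) (sub_ne_zero.2 hne'.symm)
    have hkR : (0 : ℝ) < k := by exact_mod_cast hk
    have hvR1 : (k : ℝ) * v.1 = t * d.1 := by
      have : (b.1 : ℝ) - a.1 = k * v.1 := by exact_mod_cast hv1
      simp only [toPlane] at ht1
      linarith
    have hvR2 : (k : ℝ) * v.2 = t * d.2 := by
      have : (b.2 : ℝ) - a.2 = k * v.2 := by exact_mod_cast hv2
      simp only [toPlane] at ht2
      linarith
    have hb' : b = a + (k : ℤ) • v := by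
      ext
      · simp only [Prod.fst_add, Prod.smul_fst, smul_eq_mul, ← hv1, Prod.fst_sub]; ring
      · simp only [Prod.snd_add, Prod.smul_snd, smul_eq_mul, ← hv2, Prod.snd_sub]; ring
    refine isPeriodic_of_isGeneratedBy_segment (S := S) hfin (a := a) (v := v) (m := k) ?_ ?_
      (hb' ▸ hgen b hb)
    · rintro rfl
      simp at hvw
    · intro p hp
      have hzero : v.1 * (p - a).2 - v.2 * (p - a).1 = 0 := by
        have h0 := hline p hp
        have h1 : (v.1 : ℝ) * (p.2 - a.2) - v.2 * (p.1 - a.1) = 0 := by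
          simp only [cross, toPlane] at h0
          refine mul_left_cancel₀ hkR.ne' ?_
          linear_combination t * h0 + (p.2 - a.2) * hvR1 - (p.1 - a.1) * hvR2
        simp only [Prod.fst_sub, Prod.snd_sub]
        exact_mod_cast h1
      have hcoord := coordinates_inverse hvw (p - a)
      rw [hzero] at hcoord
      set j := (p - a).1 * w.2 - (p - a).2 * w.1 with hj
      have hp' : p = a + j • v := by
        rw [← sub_eq_iff_eq_add', ← hcoord]
        ext <;> simp [coordinates]
      have hp1 : (p.1 : ℝ) = a.1 + j * v.1 := by rw [hp']; simp
      have hp2 : (p.2 : ℝ) = a.2 + j * v.2 := by rw [hp']; simp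
      have hdot : 0 < v.1 * d.1 + v.2 * d.2 := by
        refine pos_of_mul_pos_right (a := (k : ℝ)) ?_ hkR.le
        have : (k : ℝ) * (v.1 * d.1 + v.2 * d.2) = t * (d.1 * d.1 + d.2 * d.2) := by
          linear_combination d.1 * hvR1 + d.2 * hvR2
        rw [this]
        exact mul_pos htpos hnorm
      have hj0 : (0 : ℝ) ≤ j := by
        refine nonneg_of_mul_nonneg_left (b := v.1 * d.1 + v.2 * d.2) ?_ hdot
        rcases hamin p hp with h | h
        · exact absurd (hline p hp).symm h.ne
        · have := h.2
          simp only [cross, toPlane, hp1, hp2] at this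
          linarith
      have hjk : (j : ℝ) ≤ k := by
        refine le_of_mul_le_mul_right ?_ hdot
        rcases hbmin p hp with h | h
        · exact absurd ((hline p hp).trans hab).symm h.ne
        · have := h.2
          simp only [cross, ht1, ht2] at this
          simp only [toPlane, hp1, hp2] at this
          linear_combination this - d.1 * hvR1 - d.2 * hvR2
      have hj0' : 0 ≤ j := by exact_mod_cast hj0
      have hjk' : j ≤ k := by exact_mod_cast hjk
      exact ⟨j.toNat, by omega, by rw [Int.toNat_of_nonneg hj0']; exact hp'⟩

end GeneratingSets

/-! ### Expansiveness of a direction passes to its antiparallel -/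

section Reversal

variable {A : Type*} [Finite A] [TopologicalSpace A] [DiscreteTopology A] {η : ℤ × ℤ → A}

theorem eq_of_eqOn_halfPlane {n : ℕ} (hn : 1 ≤ n) {v w : ℤ × ℤ}
    (hvw : v.1 * w.2 - v.2 * w.1 = 1) (h1 : |v.1| ≤ n - 1) (h2 : |v.2| ≤ 2)
    (hX : patternCount (orbitClosure η) (rect n 3) ≤ 3 * n)
    (hexp : ∀ f ∈ orbitClosure η, ∀ g ∈ orbitClosure η,
      (∀ p : ℤ × ℤ, v.1 * p.2 - v.2 * p.1 ≤ 0 → f p = g p) → f = g)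
    {f g : ℤ × ℤ → A} (hf : f ∈ orbitClosure η) (hg : g ∈ orbitClosure η)
    (hfg : ∀ p : ℤ × ℤ, 0 ≤ v.1 * p.2 - v.2 * p.1 → f p = g p) : f = g := by
  obtain ⟨N, hN⟩ := exists_strip_determines hvw hexp
  obtain ⟨lo, s, I₀, I₁, M, hshape⟩ := exists_isReversingShape hn hvw h1 h2 hX
  have hline : ∀ f ∈ orbitClosure η, ∀ g ∈ orbitClosure η,
      (∀ p : ℤ × ℤ, 1 ≤ v.1 * p.2 - v.2 * p.1 → f p = g p) →
      ∀ p : ℤ × ℤ, v.1 * p.2 - v.2 * p.1 = 0 → f p = g p := by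
    intro f hf g hg hfg p hp
    have := hshape.eq_on_line (N := N) ?_ ?_ ⟨f, hf, rfl⟩ ⟨g, hg, rfl⟩ ?_
      (p.1 * w.2 - p.2 * w.1)
    · have hc := coordinates_inverse hvw p
      rw [hp] at hc
      simpa only [Function.comp, hc] using this
    · rintro u _ ⟨f, hf, rfl⟩
      exact ⟨_, shift_mem_orbitClosure _ hf, (shift_comp_coordinates v w u f).symm⟩
    · rintro _ ⟨f, hf, rfl⟩ _ ⟨g, hg, rfl⟩ hfg j
      refine hN f hf g hg (fun p hp hp' => ?_) _ (line_coordinates hvw _)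
      have := hfg _ (p.1 * w.2 - p.2 * w.1) hp hp'
      simpa only [Function.comp, coordinates_inverse hvw p] using this
    · intro i j hi
      exact hfg _ (by rwa [line_coordinates hvw])
  have hind : ∀ m : ℕ, ∀ p : ℤ × ℤ, -(m : ℤ) ≤ v.1 * p.2 - v.2 * p.1 → f p = g p := by
    intro m
    induction m with
    | zero => intro p hp; exact hfg p (by simpa using hp)
    | succ m ih =>
      intro p hp
      have := hline _ (shift_mem_orbitClosure p hf) _ (shift_mem_orbitClosure p hg) (by
        intro r hr
        refine ih _ ?_
        simp only [Prod.fst_add, Prod.snd_add]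
        push_cast at hp
        linarith) 0 (by simp)
      simpa [shift] using this
  funext p
  exact hind (-(v.1 * p.2 - v.2 * p.1)).toNat p (by omega)

/-- Two points of the rectangle with the same value differ by a multiple of `d`. Dividing the
difference by its gcd gives `v` and only shrinks its coordinates. -/
theorem exists_lattice_direction {d : ℝ × ℝ} {n : ℕ}
    (h : ¬ Set.InjOn (fun p => cross d (toPlane p)) (rect n 3 : Finset (ℤ × ℤ))) (hd : d ≠ 0) :
    ∃ (v w : ℤ × ℤ) (t : ℝ), v.1 * w.2 - v.2 * w.1 = 1 ∧ |v.1| ≤ n - 1 ∧ |v.2| ≤ 2 ∧ 0 < t ∧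
      d = t • toPlane v := by
  simp only [Set.InjOn] at h
  push Not at h
  obtain ⟨p, hp, q, hq, hpq, hne⟩ := h
  rw [Finset.mem_coe, mem_rect] at hp hq
  obtain ⟨v, w, k, hk, hvw, hv1, hv2⟩ := exists_primitive (d := q - p) (sub_ne_zero.2 hne.symm)
  rw [Prod.fst_sub] at hv1
  rw [Prod.snd_sub] at hv2
  have hk1 : (1 : ℤ) ≤ k := by exact_mod_cast hk
  have hle : ∀ x : ℤ, |x| ≤ |k * x| := by
    intro x
    rw [abs_mul, abs_of_pos (by omega : (0 : ℤ) < k)]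
    nlinarith [abs_nonneg x]
  have h1 : |v.1| ≤ n - 1 := (hle _).trans (by rw [← hv1, abs_le]; omega)
  have h2 : |v.2| ≤ 2 := (hle _).trans (by rw [← hv2, abs_le]; omega)
  have hkR : (k : ℝ) ≠ 0 := by exact_mod_cast hk.ne'
  have hv1R : (q.1 : ℝ) - p.1 = k * v.1 := by exact_mod_cast hv1
  have hv2R : (q.2 : ℝ) - p.2 = k * v.2 := by exact_mod_cast hv2
  have hcross : d.1 * v.2 - d.2 * v.1 = 0 := by
    simp only [cross, toPlane] at hpq
    refine mul_left_cancel₀ hkR ?_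
    linear_combination d.2 * hv1R - d.1 * hv2R - hpq
  have hvwR : (v.1 : ℝ) * w.2 - v.2 * w.1 = 1 := by exact_mod_cast hvw
  set t : ℝ := d.1 * w.2 - d.2 * w.1 with ht
  have hdt : d = t • toPlane v := by
    ext <;> simp only [toPlane, Prod.smul_fst, Prod.smul_snd, smul_eq_mul, ht]
    · linear_combination (-d.1) * hvwR - w.1 * hcross
    · linear_combination (-d.2) * hvwR - w.2 * hcross
  -- The sign of `v` is chosen so that it points along `d`.
  rcases lt_trichotomy t 0 with h0 | h0 | h0
  · refine ⟨-v, -w, -t, ?_, ?_, ?_, neg_pos.2 h0, ?_⟩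
    · simp only [Prod.fst_neg, Prod.snd_neg]; linear_combination hvw
    · simpa using h1
    · simpa using h2
    · rw [hdt]
      ext <;> simp [toPlane]
  · exact absurd (by rw [hdt, h0, zero_smul]) hd
  · exact ⟨v, w, t, hvw, h1, h2, h0, hdt⟩

theorem IsNonexpansiveDirection.antiparallel {n : ℕ}
    (hn : complexity η (rect n 3) ≤ 3 * n) {l l' : DirectedLine}
    (hl : IsNonexpansiveDirection η l) (hanti : l.IsAntiparallel l') :
    IsNonexpansiveDirection η l' := by
  obtain ⟨f, hf, g, hg, hne, hfg⟩ := hl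
  by_contra hcon
  rw [← patternCount_orbitClosure] at hn
  have hn1 : 1 ≤ n := by
    have := patternCount_pos ⟨f, hf⟩ (rect n 3)
    omega
  obtain ⟨-, r, hr, hdir⟩ := hanti
  by_cases hinj : Set.InjOn (fun p => cross l.dir (toPlane p)) (rect n 3 : Finset (ℤ × ℤ))
  · exact hne (eq_of_injOn (by rw [card_rect]; omega) hinj hf hg fun p hp => hfg hp)
  · obtain ⟨v, w, t, hvw, h1, h2, ht, hd⟩ := exists_lattice_direction hinj l.dir_ne_zero
    have hcross : ∀ p, cross l.dir (toPlane p) = t * ((v.1 * p.2 - v.2 * p.1 : ℤ) : ℝ) := by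
      intro p
      rw [hd, cross_smul_left]
      simp [cross, toPlane]
    refine hne (eq_of_eqOn_halfPlane hn1 hvw h1 h2 hn ?_ hf hg ?_)
    · intro f hf g hg hfg
      by_contra hne
      refine hcon ⟨f, hf, g, hg, hne, fun p hp => hfg p ?_⟩
      change 0 ≤ cross l'.dir (toPlane p) at hp
      rw [hdir, cross_smul_left, hcross] at hp
      have := nonpos_of_mul_nonneg_right hp hr
      exact_mod_cast nonpos_of_mul_nonpos_right this ht
    · intro p hp
      refine hfg ?_
      change 0 ≤ cross l.dir (toPlane p)
      rw [hcross]
      exact mul_nonneg ht.le (by exact_mod_cast hp)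

end Reversal

end Nivat

theorem mainTheorem5 {A : Type*} [Finite A] [Nontrivial A] [TopologicalSpace A]
    [DiscreteTopology A] (η : ℤ × ℤ → A) (haper : ¬ Nivat.IsPeriodic η)
    (hcomplexity : ∃ n : ℕ, Nivat.complexity η (Nivat.rect n 3) ≤ 3 * n)
    (l l' : Nivat.DirectedLine) (hl : Nivat.IsNonexpansiveDirection η l)
    (hanti : l.IsAntiparallel l') :
    Nivat.IsNonexpansiveDirection η l' ∧
      ∀ S : Set (ℤ × ℤ), Nivat.IsGeneratingSet η S →
        ∃ w ∈ Nivat.boundaryEdges S, Nivat.EdgeParallel w l' := by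
  obtain ⟨n, hn⟩ := hcomplexity
  have hl' := hl.antiparallel hn hanti
  exact ⟨hl', fun S hS => Nivat.exists_boundaryEdge haper hl' hS⟩
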